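/- Let $(\Omega,\mathcal F,\mathbb P)$ be a complete probability space and $\mathcal D\subset\mathbb R^d$, $d\in\{1,2\}$, a convex polygonal domain (the non-empty interior of the convex hull of finitely many points); put $H=L^2(\mathcal D)$ and let $\overline{\mathcal D}$ be the closure of $\mathcal D$. **Data.** - $W\in L^2(\Omega;H)$ is a zero-mean Gaussian random field with covariance operator $Q:H\to H$ (non-negative, symmetric, trace class), and $\omega\mapsto W(\omega,x)$ is measurable for each $x\in\mathcal D$. Let $(\eta_i,e_i)_{i\in\mathbb N}$ be the sequence of eigenpairs of $Q$ with $\eta_1\ge\eta_2\ge\dots\ge0$: the $e_i$ are orthonormal in $H$, $Qe_i=\eta_ie_i$, and $Q$ vanishes on the orthogonal complement of $\{e_i\}$. The $e_i$ are continuously differentiable on $\mathcal D$ and for some constants $\alpha,\beta,C_e,C_\eta>0$ and all $i\in\mathbb N$, $j\le d$: $\|e_i\|_{L^\infty(\mathcal D)}\le C_e$, $\|\partial_{x_j}e_i\|_{L^\infty(\mathcal D)}\le C_e i^\alpha$, and $\sum_{i}\eta_i i^\beta\le C_\eta$. - $\overline a\in C^1(\overline{\mathcal D};[0,\infty))$ with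 $\overline a\le A$ on $\overline{\mathcal D}$. - $\Phi\in C^1(\mathbb R;(0,\infty))$ satisfies, with constants $\phi_1,\dots,\phi_4>0$ and for all $w\in\mathbb R$, $$\phi_1e^{\phi_2|w|}\ge\Phi(w)\ge\phi_1e^{-\phi_2|w|},\qquad|\Phi'(w)|\le\phi_3e^{\phi_4|w|}.$$ - $\tau:\Omega\to\mathbb N$ is a random variable and $\mathcal T_1(\omega),\dots,\mathcal T_{\tau(\omega)}(\omega)$ is a random partition of $\mathcal D$: disjoint open subsets of $\mathcal D$ of positive Lebesgue measure with $\overline{\mathcal D}=\bigcup_{i\le\tau(\omega)}\overline{\mathcal T_i(\omega)}$ for every $\omega$, such that $\{(\omega,x):i\le\tau(\omega),\,x\in\mathcal T_i(\omega)\}$ is measurable in $\mathcal F\otimes\mathcal B(\mathbb R^d)$ for every $i$. - $\overline P>0$, and $(P_i)_{i\in\mathbb N}$ is a sequence of random variables with values in $[0,\overline P]$, independent of $\tau$. - $\widetilde b_1,\widetilde b_2\in L^\infty(\mathcal D)^d$. **Coefficients.** With the minimum taken componentwise, set $$a(\omega,x)=\overline a(x)+\Phi(W(\omega,x))+\sum_{i=1}^{\tau(\omega)}\mathbf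 1_{\mathcal T_i(\omega)}(x)P_i(\omega),\qquad b(\omega,x)=\min\big(a(\omega,x)\widetilde b_1(x),\widetilde b_2(x)\big).$$ For $N\in\mathbb N_0$ let $W_N=\sum_{i=1}^N\sqrt{\eta_i}\,e_iZ_i$ be the truncated Karhunen–Loève expansion of $W$, where the $Z_i$ are random variables with $\sqrt{\eta_i}Z_i=\langle W,e_i\rangle_H$ almost surely. For $\varepsilon>0$ and $s>1$ let $(\widetilde P_i)$ be random variables with values in $[0,\overline P]$ and $\mathbb E|\widetilde P_i-P_i|^s\le\varepsilon$ for all $i$. Define $a_{N,\varepsilon},b_{N,\varepsilon}$ like $a,b$ with $W_N,\widetilde P_i$ in place of $W,P_i$. Finally set $a_-(\omega)=\operatorname{ess\,inf}_{x\in\mathcal D}a(\omega,x)$, $a_+(\omega)=\operatorname{ess\,sup}_{x\in\mathcal D}a(\omega,x)$, and define $a_{N,\varepsilon,\pm}$ in the same way from $a_{N,\varepsilon}$. **Claim.** 1. For each $x\in\mathcal D$, the maps $\omega\mapsto a(\omega,x),\ b(\omega,x),\ a_{N,\varepsilon}(\omega,x),\ b_{N,\varepsilon}(\omega,x)$ are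 measurable. 2. For every $\omega\in\Omega$, $a_{N,\varepsilon,-}(\omega)>0$ and $a_{N,\varepsilon,+}(\omega)<\infty$. For almost every $\omega$, $a_-(\omega)>0$ and $a_+(\omega)<\infty$; moreover $W$ can be redefined for $\omega$ in a $\mathbb P$-null set so that it is still a field as above, and the resulting $a,b$ satisfy the measurability in 1 and these bounds for every $\omega\in\Omega$. 3. For every $q\in[1,\infty)$, $1/a_-,\ 1/a_{N,\varepsilon,-},\ a_+,\ a_{N,\varepsilon,+}\in L^q(\Omega;\mathbb R)$, and there is a constant $C>0$ depending only on $q,\phi_1,\phi_2$ and the Gaussian field $W$ (on its probability space and domain), in particular independent of $N$ and $\varepsilon$, such that $$\|1/a_-\|_{L^q(\Omega)},\ \|1/a_{N,\varepsilon,-}\|_{L^q(\Omega)}\le C,\qquad \|a_+\|_{L^q(\Omega)},\ \|a_{N,\varepsilon,+}\|_{L^q(\Omega)}\le A+C+\overline P.$$ -/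

import Mathlib

open MeasureTheory ProbabilityTheory
open scoped ENNReal

noncomputable section

namespace JumpDiffusion

/-- Euclidean space `ℝᵈ`. -/
abbrev Space (d : ℕ) : Type := EuclideanSpace ℝ (Fin d)

/-- The Hilbert space `H = L²(D)`. -/
abbrev H {d : ℕ} (D : Set (Space d)) : Type :=
  Lp ℝ 2 ((volume : Measure (Space d)).restrict D)

/-- A convex polygonal domain: the non-empty interior of the convex hull of finitely many points. -/
structure IsConvexPolygonalDomain {d : ℕ} (D : Set (Space d)) : Prop where
  nonempty : D.Nonempty
  polygonal : ∃ s : Finset (Space d), D = interior (convexHull ℝ (s : Set (Space d)))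

/-- The essential infimum over `x ∈ D` of `a(ω, x)`, as an extended real number. -/
def essInfOn {d : ℕ} {Ω : Type*} (D : Set (Space d)) (a : Ω → Space d → ℝ) (ω : Ω) : EReal :=
  essInf (fun x => ((a ω x : ℝ) : EReal)) ((volume : Measure (Space d)).restrict D)

/-- The essential supremum over `x ∈ D` of `a(ω, x)`, as an extended real number. -/
def essSupOn {d : ℕ} {Ω : Type*} (D : Set (Space d)) (a : Ω → Space d → ℝ) (ω : Ω) : EReal :=
  essSup (fun x => ((a ω x : ℝ) : EReal)) ((volume : Measure (Space d)).restrict D)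

/-- For each `x ∈ D`, the maps `a(·, x)` and `b(·, x)` are measurable. -/
def CoeffMeasurable {d : ℕ} {Ω : Type*} [MeasurableSpace Ω] (D : Set (Space d))
    (a : Ω → Space d → ℝ) (b : Ω → Space d → Fin d → ℝ) : Prop :=
  ∀ x ∈ D, Measurable (fun ω => a ω x) ∧ Measurable (fun ω => b ω x)

/-- The bounds `a₋(ω) > 0` and `a₊(ω) < ∞` at the sample point `ω`. -/
def CoeffBounded {d : ℕ} {Ω : Type*} (D : Set (Space d)) (a : Ω → Space d → ℝ) (ω : Ω) : Prop :=
  0 < essInfOn D a ω ∧ essSupOn D a ω < ⊤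

/-- `W` is a zero-mean Gaussian random field in `L²(Ω; H)` with covariance operator `Q`: every
`W(·, x)` is a random variable, `ω ↦ W(ω, ·)` is a square integrable `H`-valued random variable, all
its one-dimensional projections are centered Gaussian, and
`E[⟨f, W⟩ ⟨g, W⟩] = ⟨Q f, g⟩`. -/
structure IsCenteredGaussianField {d : ℕ} {Ω : Type*} [MeasurableSpace Ω] (D : Set (Space d))
    (μ : Measure Ω) (W : Ω → Space d → ℝ) (Q : H D →L[ℝ] H D) : Prop where
  measurable : ∀ x ∈ D, Measurable (fun ω => W ω x)
  memLp_path : ∀ ω, MemLp (W ω) 2 ((volume : Measure (Space d)).restrict D)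
  memLp_field : MemLp (fun ω => (memLp_path ω).toLp (W ω)) 2 μ
  gaussian : ∀ f : H D, HasGaussianLaw (fun ω => inner ℝ f ((memLp_path ω).toLp (W ω))) μ
  mean_zero : ∀ f : H D, ∫ ω, inner ℝ f ((memLp_path ω).toLp (W ω)) ∂μ = 0
  covariance : ∀ f g : H D,
    ∫ ω, inner ℝ f ((memLp_path ω).toLp (W ω)) * inner ℝ g ((memLp_path ω).toLp (W ω)) ∂μ
      = inner ℝ (Q f) g

/-- `((ηᵢ, eᵢ))` (indexed from `0`) is the sequence of eigenpairs of the non-negative, symmetric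
trace class operator `Q`, in decaying order: the `eᵢ` are orthonormal in `H`, `Q eᵢ = ηᵢ eᵢ`, and `Q`
vanishes on the orthogonal complement of the `eᵢ`. The `eᵢ` are given as functions. -/
structure IsEigensystem {d : ℕ} (D : Set (Space d)) (Q : H D →L[ℝ] H D) (η : ℕ → ℝ)
    (e : ℕ → Space d → ℝ) : Prop where
  positive : Q.IsPositive
  antitone : Antitone η
  nonneg : ∀ i, 0 ≤ η i
  traceClass : Summable η
  memLp : ∀ i, MemLp (e i) 2 ((volume : Measure (Space d)).restrict D)
  orthonormal : Orthonormal ℝ (fun i => (memLp i).toLp (e i))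
  eigen : ∀ i, Q ((memLp i).toLp (e i)) = η i • (memLp i).toLp (e i)
  complete : ∀ f : H D, (∀ i, inner ℝ ((memLp i).toLp (e i)) f = 0) → Q f = 0

/-- Regularity and decay of the eigenpairs; the index `i` here stands for `i + 1` when counting
from `1`. As the `eᵢ` are continuously differentiable on the open set `D`, the `L^∞(D)` norms are
suprema over `D`. -/
structure EigenBounds {d : ℕ} (D : Set (Space d)) (η : ℕ → ℝ) (e : ℕ → Space d → ℝ)
    (α β Ce Cη : ℝ) : Prop where
  α_pos : 0 < α
  β_pos : 0 < β
  Ce_pos : 0 < Ce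
  Cη_pos : 0 < Cη
  contDiffOn : ∀ i, ContDiffOn ℝ 1 (e i) D
  bound : ∀ i, ∀ x ∈ D, |e i x| ≤ Ce
  deriv_bound : ∀ i, ∀ j : Fin d, ∀ x ∈ D,
    |fderiv ℝ (e i) x (EuclideanSpace.single j 1)| ≤ Ce * ((i : ℝ) + 1) ^ α
  summable : Summable (fun i : ℕ => η i * ((i : ℝ) + 1) ^ β)
  tsum_le : ∑' i : ℕ, η i * ((i : ℝ) + 1) ^ β ≤ Cη

/-- `ā ∈ C¹(closure D; [0, ∞))`, bounded by `A`. -/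
structure IsMeanCoefficient {d : ℕ} (D : Set (Space d)) (abar : Space d → ℝ) (A : ℝ) : Prop where
  contDiffOn : ContDiffOn ℝ 1 abar (closure D)
  nonneg : ∀ x ∈ closure D, 0 ≤ abar x
  le : ∀ x ∈ closure D, abar x ≤ A

/-- `Φ ∈ C¹(ℝ; (0, ∞))` with the two-sided exponential bounds. -/
structure IsLinkFunction (Φ : ℝ → ℝ) (φ₁ φ₂ φ₃ φ₄ : ℝ) : Prop where
  contDiff : ContDiff ℝ 1 Φ
  pos : ∀ w, 0 < Φ w
  φ₁_pos : 0 < φ₁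
  φ₂_pos : 0 < φ₂
  φ₃_pos : 0 < φ₃
  φ₄_pos : 0 < φ₄
  upper : ∀ w, Φ w ≤ φ₁ * Real.exp (φ₂ * |w|)
  lower : ∀ w, φ₁ * Real.exp (-φ₂ * |w|) ≤ Φ w
  deriv_bound : ∀ w, |deriv Φ w| ≤ φ₃ * Real.exp (φ₄ * |w|)

/-- `(T₀(ω), …, T_{τ(ω) - 1}(ω))` is a random partition of `D` into disjoint open sets of positive
measure. Randomness of the open sets means that their graphs are measurable in `Ω × D`. -/
structure IsRandomPartition {d : ℕ} {Ω : Type*} [MeasurableSpace Ω] (D : Set (Space d))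
    (τ : Ω → ℕ) (T : ℕ → Ω → Set (Space d)) : Prop where
  measurable_card : Measurable τ
  measurable_graph : ∀ i, MeasurableSet {p : Ω × Space d | i < τ p.1 ∧ p.2 ∈ T i p.1}
  isOpen : ∀ ω, ∀ i < τ ω, IsOpen (T i ω)
  subset : ∀ ω, ∀ i < τ ω, T i ω ⊆ D
  disjoint : ∀ ω, ∀ i < τ ω, ∀ j < τ ω, i ≠ j → Disjoint (T i ω) (T j ω)
  volume_pos : ∀ ω, ∀ i < τ ω, 0 < volume (T i ω)
  cover : ∀ ω, closure D = ⋃ i ∈ Finset.range (τ ω), closure (T i ω)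

/-- A sequence of random variables with values in `[0, Pbar]`. -/
structure IsJumpSequence {Ω : Type*} [MeasurableSpace Ω] (J : ℕ → Ω → ℝ) (Pbar : ℝ) : Prop where
  measurable : ∀ i, Measurable (J i)
  nonneg : ∀ i ω, 0 ≤ J i ω
  le : ∀ i ω, J i ω ≤ Pbar

/-- The jump part `∑_{i < τ(ω)} 1_{Tᵢ(ω)}(x) Jᵢ(ω)`. -/
def jumpPart {d : ℕ} {Ω : Type*} (τ : Ω → ℕ) (T : ℕ → Ω → Set (Space d)) (J : ℕ → Ω → ℝ)
    (ω : Ω) (x : Space d) : ℝ :=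
  ∑ i ∈ Finset.range (τ ω), (T i ω).indicator (fun _ => J i ω) x

/-- The jump-diffusion coefficient `ā(x) + Φ(W(ω, x)) + ∑_{i < τ(ω)} 1_{Tᵢ(ω)}(x) Jᵢ(ω)`. -/
def diffusionCoeff {d : ℕ} {Ω : Type*} (abar : Space d → ℝ) (Φ : ℝ → ℝ) (W : Ω → Space d → ℝ)
    (τ : Ω → ℕ) (T : ℕ → Ω → Set (Space d)) (J : ℕ → Ω → ℝ) (ω : Ω) (x : Space d) : ℝ :=
  abar x + Φ (W ω x) + jumpPart τ T J ω x

/-- The jump-advection coefficient `min (a(ω, x) b₁(x), b₂(x))`, componentwise. -/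
def advectionCoeff {d : ℕ} {Ω : Type*} (a : Ω → Space d → ℝ) (b₁ b₂ : Space d → Fin d → ℝ)
    (ω : Ω) (x : Space d) : Fin d → ℝ :=
  fun j => min (a ω x * b₁ x j) (b₂ x j)

/-- `Z` are the Karhunen-Loève coordinates of `W`: `√ηᵢ Zᵢ = ⟨W, eᵢ⟩` almost surely. Wherever
`ηᵢ > 0` this determines `Zᵢ = ⟨W, eᵢ⟩ / √ηᵢ` (independent standard normal variables); where `ηᵢ = 0`
the variable `Zᵢ` is arbitrary, and it does not contribute to the expansion. Every sequence of
independent standard normal variables with `W = ∑ √ηᵢ eᵢ Zᵢ` in `L²(Ω; H)` has this property. -/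
structure IsKLCoordinates {d : ℕ} {Ω : Type*} [MeasurableSpace Ω] (D : Set (Space d))
    (μ : Measure Ω) (W : Ω → Space d → ℝ) (η : ℕ → ℝ) (e : ℕ → Space d → ℝ)
    (Z : ℕ → Ω → ℝ) : Prop where
  measurable : ∀ i, Measurable (Z i)
  coord : ∀ i, ∀ᵐ ω ∂μ, Real.sqrt (η i) * Z i ω = ∫ x in D, W ω x * e i x

/-- The truncated Karhunen-Loève expansion with the first `N` terms. -/
def truncatedKL {d : ℕ} {Ω : Type*} (η : ℕ → ℝ) (e : ℕ → Space d → ℝ) (Z : ℕ → Ω → ℝ) (N : ℕ)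
    (ω : Ω) (x : Space d) : ℝ :=
  ∑ i ∈ Finset.range N, Real.sqrt (η i) * e i x * Z i ω

/-- `J'` is a biased sample of the jumps `J` with values in `[0, Pbar]` and sampling error at most
`ε` in the `s`-th mean. -/
structure IsBiasedSample {Ω : Type*} [MeasurableSpace Ω] (μ : Measure Ω) (J J' : ℕ → Ω → ℝ)
    (Pbar s ε : ℝ) : Prop where
  jumps : IsJumpSequence J' Pbar
  error : ∀ i, ∫ ω, |J' i ω - J i ω| ^ s ∂μ ≤ ε

/-- The function `g` lies in `L^q(Ω; ℝ)` with norm at most `K`. -/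
def InLqWithBound {Ω : Type*} [MeasurableSpace Ω] (μ : Measure Ω) (q : ℝ≥0∞) (g : Ω → ℝ)
    (K : ℝ) : Prop :=
  MemLp g q μ ∧ eLpNorm g q μ ≤ ENNReal.ofReal K

end JumpDiffusion

end

/-! The coefficient is trapped path by path. The pieces of the partition are disjoint, so the jump
part lies in `[0, Pbar]`, and a bound `|W| ≤ m` a.e. on `D` gives `φ₁ exp(-φ₂ m) ≤ a ≤ A + φ₁ exp(φ₂
m) + Pbar` a.e. (`essInfOn_essSupOn_bounds`). The moment bounds thus reduce to bounding the
expectation of `exp(lam * sup |W_N|)` with `lam = q φ₂`, uniformly in `N`, and then passing to `W`.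

Uniformity in `N` comes from a chaining inequality, `exp_abs_le_of_modulus`: on a bounded convex
set, `exp(lam |f x|)` is controlled at every `x` by spatial integrals of `exp(2 lam |f|)` and of
`exp(τ |f y - f z| / ‖y - z‖ ^ θ)`. The right side is linear in these integrals, so by Tonelli its
expectation involves only exponential moments of values and increments at fixed points. These are
centered Gaussian projections `⟨f, W⟩`, whose variance `⟨Q f, f⟩` is diagonal in the eigenbasis.
Interpolating between the sup bound and the gradient bound on `eᵢ` with `θ = min(1, β / (2α))`
bounds the increment variance by a multiple of `‖y - z‖ ^ (2θ)`, uniformly in `N`, which cancels the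
singularity of the kernel. `exists_dominating` collects this.

For `W` itself, the covariance condition forces almost every path into the closed span of the `eᵢ`.
The expansions then converge in mean square, hence a.e. along a subsequence, and Fatou's lemma
preserves the bound (`exists_isDominatedField`). The same subsequence yields a jointly measurable
version of `W`, which makes the essential infimum and supremum measurable in `ω` up to null sets. -/

noncomputable section

namespace JumpDiffusion

/-! ### Chaining on bounded convex sets. -/

section Chaining

variable {E : Type*} [NormedAddCommGroup E] [NormedSpace ℝ E] [FiniteDimensional ℝ E]
  [MeasurableSpace E] [BorelSpace E] {ν : Measure E}

omit [NormedAddCommGroup E] [NormedSpace ℝ E] [FiniteDimensional ℝ E] [BorelSpace E] in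
/-- Two functions with controlled integrals are simultaneously controlled at some point. -/
theorem exists_mem_le_and_le {s S : Set E} (hsS : s ⊆ S) {g h : E → ℝ≥0∞}
    (hg : Measurable g) (hh : Measurable h) {a b v : ℝ} (ha : 0 < a) (hb : 0 < b) (hv : 0 < v)
    (hs : ν s = ENNReal.ofReal v)
    (hga : ∫⁻ u in S, g u ∂ν ≤ ENNReal.ofReal a) (hhb : ∫⁻ u in S, h u ∂ν ≤ ENNReal.ofReal b) :
    ∃ u ∈ s, g u ≤ ENNReal.ofReal (2 * a / v) ∧ h u ≤ ENNReal.ofReal (2 * b / v) := by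
  have hs0 : ν s ≠ 0 := by rw [hs]; simpa using hv
  have hsT : ν s ≠ ∞ := by rw [hs]; simp
  have ha0 : ENNReal.ofReal a ≠ 0 := by simpa using ha
  have hb0 : ENNReal.ofReal b ≠ 0 := by simpa using hb
  -- After normalisation each summand has integral at most `1`, so the sum has average at most `2 /
  -- v` over `s`. A point where the sum does not exceed its average controls both summands at once.
  obtain ⟨u, hu, hle⟩ := exists_le_setLAverage (f := fun u => g u / ENNReal.ofReal a
    + h u / ENNReal.ofReal b) hs0 hsT (by fun_prop)
  have hint : ∫⁻ u in s, (g u / ENNReal.ofReal a + h u / ENNReal.ofReal b) ∂ν ≤ 2 := by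
    rw [lintegral_add_left (by fun_prop)]
    simp only [div_eq_mul_inv]
    rw [lintegral_mul_const _ hg, lintegral_mul_const _ hh, ← one_add_one_eq_two]
    gcongr
    · refine le_trans (mul_le_mul_left ((lintegral_mono_set hsS).trans hga) _) ?_
      rw [ENNReal.mul_inv_cancel ha0 (by simp)]
    · refine le_trans (mul_le_mul_left ((lintegral_mono_set hsS).trans hhb) _) ?_
      rw [ENNReal.mul_inv_cancel hb0 (by simp)]
  have hle2 : g u / ENNReal.ofReal a + h u / ENNReal.ofReal b ≤ ENNReal.ofReal (2 / v) := by
    refine hle.trans ?_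
    rw [setLAverage_eq, hs, ENNReal.ofReal_div_of_pos hv]
    simpa using ENNReal.div_le_div_right hint _
  refine ⟨u, hu, ?_, ?_⟩
  · have := le_trans le_self_add hle2
    rw [ENNReal.div_le_iff ha0 (by simp), ← ENNReal.ofReal_mul (by positivity)] at this
    convert this using 2; ring
  · have := le_trans le_add_self hle2
    rw [ENNReal.div_le_iff hb0 (by simp), ← ENNReal.ofReal_mul (by positivity)] at this
    convert this using 2; ring

omit [FiniteDimensional ℝ E] [MeasurableSpace E] [BorelSpace E] in
/-- The homothetic copies of a convex set with centre in it. -/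
theorem homothety_image_subset {D : Set E} (hD : Convex ℝ D) {x : E} (hx : x ∈ D) {r : ℝ}
    (h0 : 0 ≤ r) (h1 : r ≤ 1) : AffineMap.homothety x r '' D ⊆ D := by
  rintro _ ⟨u, hu, rfl⟩
  rw [AffineMap.homothety_apply, vsub_eq_sub, vadd_eq_add, add_comm]
  exact hD.add_smul_sub_mem hx hu ⟨h0, h1⟩

theorem homothety_half_pow_volume [ν.IsAddHaarMeasure] {D : Set E} {V : ℝ}
    (hV : ν D = ENNReal.ofReal V) (x : E) (k : ℕ) :
    ν (AffineMap.homothety x ((1 / 2 : ℝ) ^ k) '' D)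
      = ENNReal.ofReal (((1 / 2 : ℝ) ^ Module.finrank ℝ E) ^ k * V) := by
  rw [Measure.addHaar_image_homothety, hV, ← ENNReal.ofReal_mul (abs_nonneg _),
    abs_of_nonneg (by positivity), ← pow_mul, ← pow_mul, mul_comm k]

/-- A sequence converging geometrically to a point of a convex set along which a kernel with
finite double integral is controlled. -/
theorem exists_chain [ν.IsAddHaarMeasure] {D : Set E} (hD : Convex ℝ D) {V : ℝ} (hV0 : 0 < V)
    (hV : ν D = ENNReal.ofReal V) {J : E → E → ℝ≥0∞} (hJ : Measurable (Function.uncurry J))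
    {K : E → ℝ≥0∞} (hK : Measurable K) {G b : ℝ} (hG : 0 < G) (hb : 0 < b)
    (hJG : ∫⁻ y in D, ∫⁻ z in D, J y z ∂ν ∂ν ≤ ENNReal.ofReal (G * V ^ 2))
    (hKb : ∫⁻ y in D, K y ∂ν ≤ ENNReal.ofReal (b * V)) {x : E} (hx : x ∈ D) :
    ∃ u : ℕ → E, (∀ k, u k ∈ AffineMap.homothety x ((1 / 2 : ℝ) ^ k) '' D) ∧
      K (u 0) ≤ ENNReal.ofReal (2 * b) ∧
      ∀ k, J (u k) (u (k + 1)) ≤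
        ENNReal.ofReal (4 * (4 ^ Module.finrank ℝ E) ^ (k + 1) * G) := by
  set d := Module.finrank ℝ E with hd
  have hp : ∀ k : ℕ, ((1 / 2 : ℝ) ^ d) ^ k = (((2 : ℝ) ^ d) ^ k)⁻¹ := by
    intro k; rw [one_div, inv_pow, inv_pow]
  have hI : Measurable fun y => ∫⁻ z in D, J y z ∂ν := hJ.lintegral_prod_right'
  -- Invariant of the chain: besides lying in the `k`-th copy of `D`, the point has a controlled
  -- partial integral of `J`. This is what allows the next point to be selected.
  let P : ℕ → E → Prop := fun k y => y ∈ AffineMap.homothety x ((1 / 2 : ℝ) ^ k) '' D ∧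
    ∫⁻ z in D, J y z ∂ν ≤ ENNReal.ofReal (2 * (2 ^ d) ^ k * G * V)
  obtain ⟨u₀, hu₀, hI₀, hK₀⟩ := exists_mem_le_and_le (ν := ν) (subset_refl D) hI hK
    (by positivity) (by positivity) hV0 hV hJG hKb
  have hP0 : P 0 u₀ := by
    refine ⟨⟨u₀, hu₀, by simp⟩, hI₀.trans_eq ?_⟩
    congr 1; field_simp
  -- The next point has to serve two purposes: a small kernel value against the current point, and a
  -- small partial integral so that the selection can continue. The `k`-th copy has volume `2 ^ (-d
  -- k) V`, which produces the powers of `2 ^ d`.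
  have hstep : ∀ k y, P k y → ∃ z, P (k + 1) z ∧
      J y z ≤ ENNReal.ofReal (4 * (4 ^ d) ^ (k + 1) * G) := by
    rintro k y ⟨-, hy⟩
    obtain ⟨z, hz, h1, h2⟩ := exists_mem_le_and_le (ν := ν)
      (homothety_image_subset hD hx (r := (1 / 2 : ℝ) ^ (k + 1)) (by positivity)
        (pow_le_one₀ (by norm_num) (by norm_num))) hI (hJ.of_uncurry_left (x := y))
      (by positivity) (by positivity) (by positivity)
      (homothety_half_pow_volume hV x (k + 1)) hJG hy
    refine ⟨z, ⟨hz, h1.trans_eq ?_⟩, h2.trans (ENNReal.ofReal_le_ofReal ?_)⟩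
    · congr 1; rw [← hd, hp]; field_simp
    · rw [← hd, hp]
      have h4 : ((4 : ℝ) ^ d) ^ (k + 1) = (2 ^ d) ^ (k + 1) * (2 ^ d) ^ (k + 1) := by
        rw [← mul_pow, ← mul_pow]; norm_num
      have h5 : ((2 : ℝ) ^ d) ^ k ≤ (2 ^ d) ^ (k + 1) :=
        pow_le_pow_right₀ (one_le_pow₀ (by norm_num)) (Nat.le_succ k)
      rw [h4]
      have : 2 * (2 * ((2 : ℝ) ^ d) ^ k * G * V) / ((((2 : ℝ) ^ d) ^ (k + 1))⁻¹ * V)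
          = 4 * ((2 ^ d) ^ (k + 1) * (2 ^ d) ^ k) * G := by field_simp; norm_num
      rw [this]
      gcongr
  choose! next hnext using hstep
  let u : ℕ → E := fun k => Nat.rec u₀ (fun k y => next k y) k
  have hu : ∀ k, P k (u k) := by
    intro k
    induction k with
    | zero => exact hP0
    | succ k ih => exact (hnext k _ ih).1
  refine ⟨u, fun k => (hu k).1, hK₀.trans_eq ?_, fun k => (hnext k _ (hu k)).2⟩
  congr 1; field_simp

/-- The modulus functional of a real function. -/
def modulusKernel (τ θ : ℝ) (f : E → ℝ) (y z : E) : ℝ≥0∞ :=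
  ENNReal.ofReal (Real.exp (τ * (|f y - f z| / ‖y - z‖ ^ θ)))

/-- The sum of the increment scales along a dyadic chain. -/
def chainRate (θ : ℝ) : ℝ := ∑' k : ℕ, ((1 / 2 : ℝ) ^ θ) ^ k

/-- The sum of the increment scales weighted by the logarithms of the covering numbers. -/
def chainEntropy (d : ℕ) (θ : ℝ) : ℝ :=
  ∑' k : ℕ, ((1 / 2 : ℝ) ^ θ) ^ k * (Real.log 4 + d * (k + 1) * Real.log 4)

theorem half_rpow_lt_one {θ : ℝ} (hθ : 0 < θ) : (1 / 2 : ℝ) ^ θ < 1 :=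
  Real.rpow_lt_one (by norm_num) (by norm_num) hθ

theorem summable_chainRate {θ : ℝ} (hθ : 0 < θ) :
    Summable fun k : ℕ => ((1 / 2 : ℝ) ^ θ) ^ k :=
  summable_geometric_of_lt_one (by positivity) (half_rpow_lt_one hθ)

theorem chainRate_pos {θ : ℝ} (hθ : 0 < θ) : 0 < chainRate θ :=
  (summable_chainRate hθ).tsum_pos (fun k => by positivity) 0 (by simp)

theorem summable_chainEntropy (d : ℕ) {θ : ℝ} (hθ : 0 < θ) :
    Summable fun k : ℕ => ((1 / 2 : ℝ) ^ θ) ^ k * (Real.log 4 + d * (k + 1) * Real.log 4) := by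
  have h1 := summable_chainRate hθ
  have h2 : Summable fun k : ℕ => (k : ℝ) ^ 1 * ((1 / 2 : ℝ) ^ θ) ^ k :=
    summable_pow_mul_geometric_of_norm_lt_one 1
      (by rw [Real.norm_of_nonneg (by positivity)]; exact half_rpow_lt_one hθ)
  refine ((h1.mul_left (Real.log 4 + d * Real.log 4)).add
    (h2.mul_left (d * Real.log 4))).congr fun k => ?_
  ring

-- Used to keep the normalised double integral `G` at least `1`, so that `log G` is non-negative.
omit [NormedSpace ℝ E] [FiniteDimensional ℝ E] [MeasurableSpace E] [BorelSpace E] in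
theorem one_le_modulusKernel {τ θ : ℝ} (hτ : 0 ≤ τ) (f : E → ℝ) (y z : E) :
    1 ≤ modulusKernel τ θ f y z := by
  rw [modulusKernel, ENNReal.one_le_ofReal]
  exact Real.one_le_exp (by positivity)

theorem measurable_modulusKernel (τ θ : ℝ) {f : E → ℝ} (hf : Measurable f) :
    Measurable (Function.uncurry (modulusKernel τ θ f)) := by
  unfold modulusKernel Function.uncurry
  fun_prop

omit [FiniteDimensional ℝ E] [MeasurableSpace E] [BorelSpace E] in
/-- Consecutive points of a chain are geometrically close. -/
theorem norm_sub_le_of_mem_homothety {D : Set E} (hD : Convex ℝ D) {R : ℝ}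
    (hR : ∀ y ∈ D, ∀ z ∈ D, ‖y - z‖ ≤ R) {x : E} (hx : x ∈ D) {k : ℕ} {y z : E}
    (hy : y ∈ AffineMap.homothety x ((1 / 2 : ℝ) ^ k) '' D)
    (hz : z ∈ AffineMap.homothety x ((1 / 2 : ℝ) ^ (k + 1)) '' D) :
    ‖y - z‖ ≤ R * (1 / 2) ^ k := by
  obtain ⟨p, hp, rfl⟩ := hy
  obtain ⟨q, hq, rfl⟩ := hz
  have hq' : x + (1 / 2 : ℝ) • (q - x) ∈ D := hD.add_smul_sub_mem hx hq ⟨by norm_num, by norm_num⟩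
  have : AffineMap.homothety x ((1 / 2 : ℝ) ^ k) p - AffineMap.homothety x ((1 / 2 : ℝ) ^ (k + 1)) q
      = ((1 / 2 : ℝ) ^ k) • (p - (x + (1 / 2 : ℝ) • (q - x))) := by
    simp only [AffineMap.homothety_apply, vsub_eq_sub, vadd_eq_add, pow_succ]
    module
  rw [this, norm_smul, Real.norm_of_nonneg (by positivity), mul_comm]
  gcongr
  exact hR _ hp _ hq'

omit [FiniteDimensional ℝ E] [MeasurableSpace E] [BorelSpace E] in
theorem tendsto_of_mem_homothety {D : Set E} {R : ℝ}
    (hR : ∀ y ∈ D, ∀ z ∈ D, ‖y - z‖ ≤ R) {x : E} (hx : x ∈ D) {u : ℕ → E}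
    (hu : ∀ k, u k ∈ AffineMap.homothety x ((1 / 2 : ℝ) ^ k) '' D) :
    Filter.Tendsto u Filter.atTop (nhds x) := by
  rw [tendsto_iff_norm_sub_tendsto_zero]
  have h0 : Filter.Tendsto (fun k : ℕ => (1 / 2 : ℝ) ^ k * R) Filter.atTop (nhds 0) := by
    simpa using (tendsto_pow_atTop_nhds_zero_of_lt_one (r := (1 / 2 : ℝ)) (by norm_num)
      (by norm_num)).mul_const R
  refine squeeze_zero (fun _ => norm_nonneg _) (fun k => ?_) h0
  obtain ⟨p, hp, h⟩ := hu k
  rw [← h, AffineMap.homothety_apply, vsub_eq_sub, vadd_eq_add, add_sub_cancel_right, norm_smul,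
    Real.norm_of_nonneg (by positivity)]
  gcongr
  exact hR _ hp _ hx

omit [NormedSpace ℝ E] [FiniteDimensional ℝ E] [MeasurableSpace E] [BorelSpace E] in
/-- A bound on the kernel is a bound on the increment. -/
theorem abs_sub_le_of_modulusKernel_le {τ θ : ℝ} (hτ : 0 < τ) (hθ : 0 < θ) {f : E → ℝ} {y z : E}
    {r c : ℝ} (hr : ‖y - z‖ ≤ r) (hc : 0 ≤ c)
    (h : modulusKernel τ θ f y z ≤ ENNReal.ofReal (Real.exp c)) :
    |f y - f z| ≤ r ^ θ * c / τ := by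
  have hr0 : 0 ≤ r := (norm_nonneg _).trans hr
  rw [modulusKernel, ENNReal.ofReal_le_ofReal_iff (Real.exp_pos _).le, Real.exp_le_exp] at h
  -- On the diagonal the quotient in the kernel is `0 / 0 = 0`, so the hypothesis carries no
  -- information there; the increment vanishes anyway.
  rcases (norm_nonneg (y - z)).eq_or_lt with h0 | h0
  · rw [eq_comm, norm_eq_zero, sub_eq_zero] at h0
    rw [h0, sub_self, abs_zero]; positivity
  · have h1 : 0 < ‖y - z‖ ^ θ := by positivity
    have h2 : ‖y - z‖ ^ θ ≤ r ^ θ := Real.rpow_le_rpow h0.le hr hθ.le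
    rw [← mul_div_assoc, div_le_iff₀ h1] at h
    rw [le_div_iff₀ hτ, mul_comm]
    calc τ * |f y - f z| ≤ c * ‖y - z‖ ^ θ := h
      _ ≤ c * r ^ θ := by gcongr
      _ = r ^ θ * c := mul_comm _ _

/-- A Garsia-Rodemich-Rumsey inequality on a bounded convex set in exponential form. -/
theorem exp_abs_le_of_modulus [ν.IsAddHaarMeasure] {D : Set E} (hD : Convex ℝ D) {V R : ℝ}
    (hV0 : 0 < V) (hV : ν D = ENNReal.ofReal V) (hR0 : 0 < R)
    (hR : ∀ y ∈ D, ∀ z ∈ D, ‖y - z‖ ≤ R) {θ lam : ℝ} (hθ : 0 < θ) (hlam : 0 < lam)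
    {f : E → ℝ} (hf : Measurable f) (hfc : ContinuousOn f D) {x : E} (hx : x ∈ D) :
    ENNReal.ofReal (Real.exp (lam * |f x|)) ≤
      ENNReal.ofReal (2 * Real.exp (chainEntropy (Module.finrank ℝ E) θ / (2 * chainRate θ))) *
        (ENNReal.ofReal V⁻¹ * ∫⁻ y in D, ENNReal.ofReal (Real.exp (2 * lam * |f y|)) ∂ν +
          ENNReal.ofReal (V ^ 2)⁻¹ * ∫⁻ y in D, ∫⁻ z in D,
            modulusKernel (2 * lam * R ^ θ * chainRate θ) θ f y z ∂ν ∂ν) := by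
  set d := Module.finrank ℝ E with hd
  set S₀ := chainRate θ with hS₀
  set S₁ := chainEntropy d θ with hS₁
  set τ := 2 * lam * R ^ θ * S₀ with hτ
  have hS₀0 : 0 < S₀ := chainRate_pos hθ
  have hτ0 : 0 < τ := by positivity
  set B := ∫⁻ y in D, ENNReal.ofReal (Real.exp (2 * lam * |f y|)) ∂ν with hB
  set I := ∫⁻ y in D, ∫⁻ z in D, modulusKernel τ θ f y z ∂ν ∂ν with hI
  have hc0 : ENNReal.ofReal (2 * Real.exp (S₁ / (2 * S₀))) ≠ 0 := by
    simpa using Real.exp_pos _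
  -- If either integral is infinite the right side is `∞`; otherwise both can be handled as real
  -- numbers.
  by_cases hBT : B = ∞
  · rw [hBT, ENNReal.mul_top (by simpa using hV0), top_add, ENNReal.mul_top hc0]
    exact le_top
  by_cases hIT : I = ∞
  · rw [hIT, ENNReal.mul_top (by simpa using hV0.ne'), add_top, ENNReal.mul_top hc0]
    exact le_top
  have hVB : ENNReal.ofReal V ≤ B := by
    rw [← hV, ← setLIntegral_one]
    refine lintegral_mono fun y => ?_
    rw [ENNReal.one_le_ofReal]
    exact Real.one_le_exp (by positivity)
  have hVI : ENNReal.ofReal (V ^ 2) ≤ I := by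
    calc ENNReal.ofReal (V ^ 2) = ∫⁻ _ in D, ∫⁻ _ in D, 1 ∂ν ∂ν := by
          rw [setLIntegral_one, setLIntegral_const, hV, ← ENNReal.ofReal_mul hV0.le, sq]
      _ ≤ I := lintegral_mono fun y => lintegral_mono fun z => one_le_modulusKernel hτ0.le f y z
  set b := B.toReal / V with hb
  set G := I.toReal / V ^ 2 with hG
  have hb1 : 1 ≤ b := by
    rw [hb, one_le_div hV0]; exact (ENNReal.ofReal_le_iff_le_toReal hBT).1 hVB
  have hG1 : 1 ≤ G := by
    rw [hG, one_le_div (by positivity)]; exact (ENNReal.ofReal_le_iff_le_toReal hIT).1 hVI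
  have hBb : B = ENNReal.ofReal (b * V) := by
    rw [hb, div_mul_cancel₀ _ hV0.ne', ENNReal.ofReal_toReal hBT]
  have hIG : I = ENNReal.ofReal (G * V ^ 2) := by
    rw [hG, div_mul_cancel₀ _ (by positivity), ENNReal.ofReal_toReal hIT]
  obtain ⟨u, hu, hu0, hus⟩ := exists_chain hD hV0 hV (measurable_modulusKernel τ θ hf)
    (K := fun y => ENNReal.ofReal (Real.exp (2 * lam * |f y|))) (by fun_prop)
    (by positivity) (by positivity) hIG.le hBb.le hx
  have h0 : |f (u 0)| ≤ Real.log (2 * b) / (2 * lam) := by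
    rw [ENNReal.ofReal_le_ofReal_iff (by positivity), ← Real.le_log_iff_exp_le (by positivity)]
      at hu0
    rw [le_div_iff₀ (by positivity)]; linarith
  have hlogG : 0 ≤ Real.log G := Real.log_nonneg hG1
  have hlog4 : 0 ≤ Real.log 4 := Real.log_nonneg (by norm_num)
  -- The increment scale is `(R 2 ^ (-k)) ^ θ`. The choice of `τ` cancels `R ^ θ` and leaves `2 lam
  -- S₀` in the denominator, so the `log G` terms sum to at most `log G / (2 lam)`.
  have hinc : ∀ k, |f (u k) - f (u (k + 1))| ≤ ((1 / 2 : ℝ) ^ θ) ^ k *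
      ((Real.log 4 + d * (k + 1) * Real.log 4) + Real.log G) / (2 * lam * S₀) := by
    intro k
    have h := hus k
    have hc : 4 * (4 ^ d) ^ (k + 1) * G
        = Real.exp ((Real.log 4 + d * (k + 1) * Real.log 4) + Real.log G) := by
      rw [Real.exp_add, Real.exp_add, Real.exp_log (by positivity), Real.exp_log (by positivity),
        ← pow_mul, ← Real.rpow_natCast, Real.rpow_def_of_pos (by norm_num)]
      push_cast
      ring_nf
    rw [← hd, hc] at h
    refine (abs_sub_le_of_modulusKernel_le hτ0 hθ
      (norm_sub_le_of_mem_homothety hD hR hx (hu k) (hu (k + 1))) (by positivity) h).trans_eq ?_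
    have hpow : ((1 / 2 : ℝ) ^ k) ^ θ = ((1 / 2 : ℝ) ^ θ) ^ k := by
      rw [← Real.rpow_natCast, ← Real.rpow_natCast, ← Real.rpow_mul (by norm_num),
        ← Real.rpow_mul (by norm_num), mul_comm]
    rw [Real.mul_rpow hR0.le (by positivity), hpow, hτ]
    field_simp
  have hsum : ∀ n, |f (u n)| ≤ Real.log (2 * b) / (2 * lam)
      + (S₁ + S₀ * Real.log G) / (2 * lam * S₀) := by
    intro n
    have h1 : |f (u n)| ≤ |f (u 0)| + ∑ k ∈ Finset.range n, |f (u k) - f (u (k + 1))| := by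
      induction n with
      | zero => simp
      | succ n ih =>
        rw [Finset.sum_range_succ]
        have := abs_sub_abs_le_abs_sub (f (u (n + 1))) (f (u n))
        rw [abs_sub_comm] at this
        linarith
    refine h1.trans (add_le_add h0 ((Finset.sum_le_sum fun k _ => hinc k).trans ?_))
    rw [← Finset.sum_div]
    gcongr
    simp_rw [mul_add _ _ (Real.log G), Finset.sum_add_distrib, ← Finset.sum_mul]
    gcongr
    · exact (summable_chainEntropy d hθ).sum_le_tsum _ fun k _ => by positivity
    · exact (summable_chainRate hθ).sum_le_tsum _ fun k _ => by positivity
  have hlim : |f x| ≤ Real.log (2 * b) / (2 * lam)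
      + (S₁ + S₀ * Real.log G) / (2 * lam * S₀) := by
    have huD : ∀ k, u k ∈ D := fun k => homothety_image_subset hD hx (by positivity)
      (pow_le_one₀ (by norm_num) (by norm_num)) (hu k)
    have ht : Filter.Tendsto (fun n => f (u n)) Filter.atTop (nhds (f x)) :=
      (hfc x hx).tendsto.comp (tendsto_nhdsWithin_iff.2
        ⟨tendsto_of_mem_homothety hR hx hu, Filter.Eventually.of_forall huD⟩)
    exact le_of_tendsto' ht.abs hsum
  have hb' : ENNReal.ofReal V⁻¹ * B = ENNReal.ofReal b := by
    rw [hBb, ← ENNReal.ofReal_mul (by positivity)]; congr 1; field_simp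
  have hG' : ENNReal.ofReal (V ^ 2)⁻¹ * I = ENNReal.ofReal G := by
    rw [hIG, ← ENNReal.ofReal_mul (by positivity)]; congr 1; field_simp
  rw [hb', hG', ← ENNReal.ofReal_add (by positivity) (by positivity),
    ← ENNReal.ofReal_mul (by positivity)]
  refine ENNReal.ofReal_le_ofReal ?_
  -- The factors `2` in the exponents on the right pay off here: the two logarithms enter with
  -- weight `1/2` each, so their maximum suffices, and the final bound is a sum of the two integrals
  -- instead of a product.
  have h2 : lam * |f x| ≤ S₁ / (2 * S₀) + max (Real.log (2 * b)) (Real.log G) := by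
    have h3 := mul_le_mul_of_nonneg_left hlim hlam.le
    have h4 : lam * (Real.log (2 * b) / (2 * lam) + (S₁ + S₀ * Real.log G) / (2 * lam * S₀))
        = S₁ / (2 * S₀) + (Real.log (2 * b) + Real.log G) / 2 := by field_simp; ring
    have := le_max_left (Real.log (2 * b)) (Real.log G)
    have := le_max_right (Real.log (2 * b)) (Real.log G)
    linarith
  have h5 : Real.exp (max (Real.log (2 * b)) (Real.log G)) ≤ 2 * (b + G) := by
    rcases max_choice (Real.log (2 * b)) (Real.log G) with h | h <;> rw [h] <;>
      rw [Real.exp_log (by positivity)] <;> linarith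
  calc Real.exp (lam * |f x|)
      ≤ Real.exp (S₁ / (2 * S₀)) * Real.exp (max (Real.log (2 * b)) (Real.log G)) := by
        rw [← Real.exp_add]; exact Real.exp_le_exp.2 h2
    _ ≤ Real.exp (S₁ / (2 * S₀)) * (2 * (b + G)) := by gcongr
    _ = _ := by ring

end Chaining

/-! ### Exponential moments of Gaussian variables. -/

section GaussianMoments

variable {Ω : Type*} [MeasurableSpace Ω] {μ : Measure Ω}

/-- Exponential moments of the absolute value of a centered Gaussian variable. -/
theorem lintegral_exp_mul_abs_le {X : Ω → ℝ} (hX : HasGaussianLaw X μ) (h0 : ∫ ω, X ω ∂μ = 0)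
    {v : ℝ} (hv : ∫ ω, X ω * X ω ∂μ ≤ v) (t : ℝ) :
    ∫⁻ ω, ENNReal.ofReal (Real.exp (t * |X ω|)) ∂μ ≤
      ENNReal.ofReal (2 * Real.exp (t ^ 2 * v / 2)) := by
  have hmap := hX.map_eq_gaussianReal
  have hvar : Var[X; μ] = ∫ ω, X ω * X ω ∂μ := by
    rw [variance_of_integral_eq_zero hX.aemeasurable h0]
    simp only [sq]
  have hone : ∀ s : ℝ, s ^ 2 = t ^ 2 → ∫⁻ ω, ENNReal.ofReal (Real.exp (s * X ω)) ∂μ ≤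
      ENNReal.ofReal (Real.exp (t ^ 2 * v / 2)) := by
    intro s hs
    have hint : Integrable (fun ω => Real.exp (s * X ω)) μ := by
      have := integrable_exp_mul_gaussianReal (μ := μ[X]) (v := Var[X; μ].toNNReal) s
      rw [← hmap, integrable_map_measure (by fun_prop) hX.aemeasurable] at this
      exact this
    rw [← ofReal_integral_eq_lintegral_ofReal hint
      (Filter.Eventually.of_forall fun _ => (Real.exp_pos _).le)]
    refine ENNReal.ofReal_le_ofReal ?_
    have hm := mgf_gaussianReal hmap s
    rw [mgf] at hm
    rw [hm, h0, Real.coe_toNNReal _ (variance_nonneg _ _), hvar, hs]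
    refine Real.exp_le_exp.2 ?_
    nlinarith [sq_nonneg t]
  calc ∫⁻ ω, ENNReal.ofReal (Real.exp (t * |X ω|)) ∂μ
      ≤ ∫⁻ ω, (ENNReal.ofReal (Real.exp (t * X ω)) + ENNReal.ofReal (Real.exp (-t * X ω))) ∂μ := by
        refine lintegral_mono fun ω => ?_
        rcases abs_choice (X ω) with h | h <;> rw [h]
        · exact le_self_add
        · rw [mul_neg, ← neg_mul]; exact le_add_self
    _ = ∫⁻ ω, ENNReal.ofReal (Real.exp (t * X ω)) ∂μ
        + ∫⁻ ω, ENNReal.ofReal (Real.exp (-t * X ω)) ∂μ := by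
        have := hX.aemeasurable
        exact lintegral_add_left' (by fun_prop) _
    _ ≤ _ := by
        refine (add_le_add (hone t rfl) (hone (-t) (by ring))).trans_eq ?_
        rw [← ENNReal.ofReal_add (by positivity) (by positivity), two_mul]

end GaussianMoments

/-! ### Uniform exponential bounds for the truncated expansions. -/

section Field

variable {d : ℕ} {D : Set (Space d)} {Ω : Type*} [MeasurableSpace Ω] {μ : Measure Ω}
  {W : Ω → Space d → ℝ} {Q : H D →L[ℝ] H D} {η : ℕ → ℝ} {e : ℕ → Space d → ℝ}
  {α β Ce Cη : ℝ}

/-- The path of a Gaussian field as an element of `H`. -/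
def IsCenteredGaussianField.path (hW : IsCenteredGaussianField D μ W Q) (ω : Ω) : H D :=
  (hW.memLp_path ω).toLp (W ω)

/-- The eigenfunctions as elements of `H`. -/
def IsEigensystem.vec (hQ : IsEigensystem D Q η e) (i : ℕ) : H D := (hQ.memLp i).toLp (e i)

/-- `Y` is a measurable version of the coordinates of `W` in the eigenbasis. -/
structure IsCoordinateVersion (hW : IsCenteredGaussianField D μ W Q) (hQ : IsEigensystem D Q η e)
    (Y : ℕ → Ω → ℝ) : Prop where
  measurable : ∀ i, Measurable (Y i)
  coord : ∀ i, ∀ᵐ ω ∂μ, Y i ω = inner ℝ (hQ.vec i) (hW.path ω)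

/-- Expansion with respect to the functions `e`. -/
def expansion (e : ℕ → Space d → ℝ) (Y : ℕ → Ω → ℝ) (N : ℕ) (ω : Ω) (x : Space d) : ℝ :=
  ∑ i ∈ Finset.range N, e i x * Y i ω

theorem IsEigensystem.inner_sum_vec (hQ : IsEigensystem D Q η e) (c : ℕ → ℝ) (N : ℕ) :
    inner ℝ (Q (∑ i ∈ Finset.range N, c i • hQ.vec i)) (∑ i ∈ Finset.range N, c i • hQ.vec i)
      = ∑ i ∈ Finset.range N, η i * c i ^ 2 := by
  have h1 : Q (∑ i ∈ Finset.range N, c i • hQ.vec i)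
      = ∑ i ∈ Finset.range N, (η i * c i) • hQ.vec i := by
    rw [map_sum]
    refine Finset.sum_congr rfl fun i _ => ?_
    rw [map_smul, IsEigensystem.vec, hQ.eigen i, smul_smul, mul_comm]
  have h2 : Orthonormal ℝ hQ.vec := hQ.orthonormal
  rw [h1, h2.inner_sum]
  refine Finset.sum_congr rfl fun i _ => ?_
  simp only [conj_trivial]
  ring

/-- A combination of coordinates is almost surely the single projection `⟨f, W⟩` with `f = ∑ cᵢ eᵢ`,
so its Gaussian law is part of the definition of the field, and independence of the coordinates is
not required. -/
theorem lintegral_exp_mul_abs_sum_le [IsProbabilityMeasure μ]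
    (hW : IsCenteredGaussianField D μ W Q) (hQ : IsEigensystem D Q η e) {Y : ℕ → Ω → ℝ}
    (hY : IsCoordinateVersion hW hQ Y) (c : ℕ → ℝ) (N : ℕ) {v : ℝ}
    (hv : ∑ i ∈ Finset.range N, η i * c i ^ 2 ≤ v) (t : ℝ) :
    ∫⁻ ω, ENNReal.ofReal (Real.exp (t * |∑ i ∈ Finset.range N, c i * Y i ω|)) ∂μ ≤
      ENNReal.ofReal (2 * Real.exp (t ^ 2 * v / 2)) := by
  set f : H D := ∑ i ∈ Finset.range N, c i • hQ.vec i with hf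
  have hae : ∀ᵐ ω ∂μ, ∑ i ∈ Finset.range N, c i * Y i ω = inner ℝ f (hW.path ω) := by
    filter_upwards [ae_all_iff.2 hY.coord] with ω hω
    rw [hf, sum_inner]
    refine Finset.sum_congr rfl fun i _ => ?_
    rw [hω i, real_inner_smul_left]
  rw [lintegral_congr_ae (g := fun ω => ENNReal.ofReal (Real.exp (t * |inner ℝ f (hW.path ω)|)))
    (by filter_upwards [hae] with ω hω; rw [hω])]
  refine lintegral_exp_mul_abs_le (hW.gaussian f) (hW.mean_zero f) ?_ t
  rw [hW.covariance f f, hf, hQ.inner_sum_vec]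
  exact hv

/-- The Hölder exponent of the eigenfunctions that is compensated by the decay of eigenvalues. -/
def holderExponent (α β : ℝ) : ℝ := min 1 (β / (2 * α))

theorem norm_fderiv_le_of_partial {f : Space d → ℝ} {x : Space d} {C : ℝ}
    (h : ∀ j : Fin d, |fderiv ℝ f x (EuclideanSpace.single j 1)| ≤ C) :
    ‖fderiv ℝ f x‖ ≤ d * |C| := by
  refine ContinuousLinearMap.opNorm_le_bound _ (by positivity) fun v => ?_
  have hv : v = ∑ j, v j • EuclideanSpace.single j (1 : ℝ) := by
    simpa using ((EuclideanSpace.basisFun (Fin d) ℝ).sum_repr v).symm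
  conv_lhs => rw [hv]
  rw [map_sum]
  calc ‖∑ j, fderiv ℝ f x (v j • EuclideanSpace.single j 1)‖
      ≤ ∑ _j : Fin d, ‖v‖ * |C| := by
        refine norm_sum_le_of_le _ fun j _ => ?_
        rw [map_smul, norm_smul]
        exact mul_le_mul (PiLp.norm_apply_le v j) ((h j).trans (le_abs_self C))
          (norm_nonneg _) (norm_nonneg _)
    _ = d * |C| * ‖v‖ := by simp; ring

theorem min_one_le_rpow {m θ : ℝ} (hm : 0 ≤ m) (hθ0 : 0 < θ) (hθ1 : θ ≤ 1) :
    min 1 m ≤ m ^ θ := by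
  rcases le_total 1 m with h | h
  · exact (min_le_left _ _).trans (Real.one_le_rpow h hθ0.le)
  · refine (min_le_right _ _).trans ?_
    rcases hm.eq_or_lt with h0 | h0
    · rw [← h0, Real.zero_rpow hθ0.ne']
    · simpa using Real.rpow_le_rpow_of_exponent_ge h0 h hθ1

theorem EigenBounds.holderExponent_pos (he : EigenBounds D η e α β Ce Cη) :
    0 < holderExponent α β :=
  lt_min one_pos (div_pos he.β_pos (mul_pos two_pos he.α_pos))

/-- Interpolation: `|e i y - e i z|` is at most `2 Ce` and at most `Ce m`, hence at most `2 Ce m ^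
θ`. Squaring costs the factor `(i + 1) ^ (2αθ)`, which `θ ≤ β / (2α)` keeps below the weight `(i +
1) ^ β` that the eigenvalues can absorb. -/
theorem EigenBounds.sq_sub_le (he : EigenBounds D η e α β Ce Cη) (hD : Convex ℝ D)
    (hDo : IsOpen D) (i : ℕ) {y z : Space d} (hy : y ∈ D) (hz : z ∈ D) :
    (e i y - e i z) ^ 2 ≤ 4 * Ce ^ 2 * ((d : ℝ) ^ holderExponent α β) ^ 2
      * (‖y - z‖ ^ holderExponent α β) ^ 2 * ((i : ℝ) + 1) ^ β := by
  set θ := holderExponent α β with hθ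
  have hθ0 : 0 < θ := he.holderExponent_pos
  have hθ1 : θ ≤ 1 := min_le_left _ _
  have hi : (1 : ℝ) ≤ (i : ℝ) + 1 := by linarith [Nat.cast_nonneg (α := ℝ) i]
  have hCe := he.Ce_pos
  set m := (d : ℝ) * (((i : ℝ) + 1) ^ α * ‖y - z‖) with hm
  have hm0 : 0 ≤ m := by positivity
  have h1 : |e i y - e i z| ≤ 2 * Ce * 1 := by
    have := abs_sub (e i y) (e i z)
    linarith [he.bound i y hy, he.bound i z hz]
  have h2 : |e i y - e i z| ≤ Ce * m := by
    have hb : ∀ x ∈ D, ‖fderiv ℝ (e i) x‖ ≤ d * (Ce * ((i : ℝ) + 1) ^ α) := fun x hx => by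
      have := norm_fderiv_le_of_partial (fun j => he.deriv_bound i j x hx)
      rwa [abs_of_nonneg (by positivity)] at this
    have := hD.norm_image_sub_le_of_norm_fderiv_le
      (fun x hx => ((he.contDiffOn i).contDiffAt (hDo.mem_nhds hx)).differentiableAt one_ne_zero)
      hb hz hy
    rw [Real.norm_eq_abs] at this
    refine this.trans_eq ?_
    rw [hm]; ring
  have h3 : |e i y - e i z| ≤ 2 * Ce * m ^ θ := by
    refine le_trans ?_ (mul_le_mul_of_nonneg_left (min_one_le_rpow hm0 hθ0 hθ1) (by positivity))
    rw [mul_min_of_nonneg _ _ (by positivity)]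
    exact le_min h1 (h2.trans (by nlinarith [mul_nonneg hCe.le hm0]))
  have h4 : (((i : ℝ) + 1) ^ α) ^ θ * (((i : ℝ) + 1) ^ α) ^ θ ≤ ((i : ℝ) + 1) ^ β := by
    rw [← Real.rpow_mul (by positivity), ← Real.rpow_add (by positivity)]
    refine Real.rpow_le_rpow_of_exponent_le hi ?_
    have : θ ≤ β / (2 * α) := min_le_right _ _
    rw [le_div_iff₀ (mul_pos two_pos he.α_pos)] at this
    linarith
  rw [← sq_abs]
  calc |e i y - e i z| ^ 2 ≤ (2 * Ce * m ^ θ) ^ 2 := by gcongr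
    _ = 4 * Ce ^ 2 * ((d : ℝ) ^ θ) ^ 2 * (‖y - z‖ ^ θ) ^ 2
        * ((((i : ℝ) + 1) ^ α) ^ θ * (((i : ℝ) + 1) ^ α) ^ θ) := by
        rw [hm, Real.mul_rpow (by positivity) (by positivity),
          Real.mul_rpow (by positivity) (by positivity)]
        ring
    _ ≤ _ := by gcongr

theorem EigenBounds.sum_le (he : EigenBounds D η e α β Ce Cη) (hη : ∀ i, 0 ≤ η i) (N : ℕ) :
    ∑ i ∈ Finset.range N, η i * ((i : ℝ) + 1) ^ β ≤ Cη :=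
  (he.summable.sum_le_tsum _ fun i _ => mul_nonneg (hη i) (by positivity)).trans he.tsum_le

theorem EigenBounds.variance_le (he : EigenBounds D η e α β Ce Cη) (hη : ∀ i, 0 ≤ η i) (N : ℕ)
    {x : Space d} (hx : x ∈ D) :
    ∑ i ∈ Finset.range N, η i * e i x ^ 2 ≤ Ce ^ 2 * Cη := by
  refine le_trans ?_ (mul_le_mul_of_nonneg_left (he.sum_le hη N) (sq_nonneg Ce))
  rw [Finset.mul_sum]
  refine Finset.sum_le_sum fun i _ => ?_
  have h1 : e i x ^ 2 ≤ Ce ^ 2 := sq_le_sq' (abs_le.1 (he.bound i x hx)).1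
    (abs_le.1 (he.bound i x hx)).2
  have h2 : (1 : ℝ) ≤ ((i : ℝ) + 1) ^ β :=
    Real.one_le_rpow (by linarith [Nat.cast_nonneg (α := ℝ) i]) he.β_pos.le
  calc η i * e i x ^ 2 ≤ η i * Ce ^ 2 := by gcongr; exact hη i
    _ ≤ Ce ^ 2 * (η i * ((i : ℝ) + 1) ^ β) := by
      nlinarith [mul_nonneg (hη i) (sq_nonneg Ce)]

theorem EigenBounds.increment_variance_le (he : EigenBounds D η e α β Ce Cη) (hη : ∀ i, 0 ≤ η i)
    (hD : Convex ℝ D) (hDo : IsOpen D) (N : ℕ) {y z : Space d} (hy : y ∈ D) (hz : z ∈ D) :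
    ∑ i ∈ Finset.range N, η i * (e i y - e i z) ^ 2 ≤
      4 * Ce ^ 2 * ((d : ℝ) ^ holderExponent α β) ^ 2 * Cη
        * (‖y - z‖ ^ holderExponent α β) ^ 2 := by
  set c := 4 * Ce ^ 2 * ((d : ℝ) ^ holderExponent α β) ^ 2
      * (‖y - z‖ ^ holderExponent α β) ^ 2 with hc
  have h : ∑ i ∈ Finset.range N, η i * (e i y - e i z) ^ 2
      ≤ c * ∑ i ∈ Finset.range N, η i * ((i : ℝ) + 1) ^ β := by
    rw [Finset.mul_sum]
    refine Finset.sum_le_sum fun i _ => ?_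
    have := mul_le_mul_of_nonneg_left (he.sq_sub_le hD hDo i hy hz) (hη i)
    refine this.trans_eq ?_
    rw [hc]; ring
  refine (h.trans (mul_le_mul_of_nonneg_left (he.sum_le hη N) (by positivity))).trans_eq ?_
  rw [hc]; ring

omit [MeasurableSpace Ω] in
theorem continuousOn_expansion (he : EigenBounds D η e α β Ce Cη) (Y : ℕ → Ω → ℝ) (N : ℕ)
    (ω : Ω) : ContinuousOn (expansion e Y N ω) D :=
  continuousOn_finsetSum _ fun i _ => (he.contDiffOn i).continuousOn.mul continuousOn_const

/-- Nothing is known about `e i` as a pointwise function outside `D`; cutting it off there gives the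
measurability needed for Tonelli without changing any value on `D`. -/
theorem EigenBounds.measurable_indicator (he : EigenBounds D η e α β Ce Cη) (hDo : IsOpen D)
    (i : ℕ) : Measurable (D.indicator (e i)) := by
  classical
  rw [← Set.piecewise_eq_indicator]
  exact (he.contDiffOn i).continuousOn.measurable_piecewise continuousOn_const hDo.measurableSet

omit [MeasurableSpace Ω] in
theorem expansion_indicator (Y : ℕ → Ω → ℝ) (N : ℕ) (ω : Ω) {x : Space d} (hx : x ∈ D) :
    expansion (fun i => D.indicator (e i)) Y N ω x = expansion e Y N ω x :=
  Finset.sum_congr rfl fun i _ => by simp only [Set.indicator_of_mem hx]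

theorem measurable_expansion {e : ℕ → Space d → ℝ} (he : ∀ i, Measurable (e i)) {Y : ℕ → Ω → ℝ}
    (hY : ∀ i, Measurable (Y i)) (N : ℕ) :
    Measurable fun p : Ω × Space d => expansion e Y N p.1 p.2 := by
  unfold expansion
  fun_prop

theorem lintegral_setLIntegral_le {E : Type*} [MeasurableSpace E] {ν : Measure E} [SFinite ν]
    [SFinite μ] {s : Set E} {f : Ω → E → ℝ≥0∞} (hf : Measurable fun p : Ω × E => f p.1 p.2)
    {K : ℝ≥0∞} (hK : ∀ y ∈ s, ∫⁻ ω, f ω y ∂μ ≤ K) :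
    ∫⁻ ω, ∫⁻ y in s, f ω y ∂ν ∂μ ≤ K * ν s := by
  rw [lintegral_lintegral_swap hf.aemeasurable, ← setLIntegral_const]
  exact setLIntegral_mono measurable_const hK

/-- The truncated expansions are dominated, uniformly in the number of terms, by random variables
with bounded expectation. -/
theorem exists_dominating [IsProbabilityMeasure μ] (hD : Convex ℝ D) (hDo : IsOpen D)
    (hDb : Bornology.IsBounded D) (hDn : D.Nonempty)
    (hW : IsCenteredGaussianField D μ W Q) (hQ : IsEigensystem D Q η e)
    (he : EigenBounds D η e α β Ce Cη) {lam : ℝ} (hlam : 0 < lam) :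
    ∃ K : ℝ≥0∞, K ≠ ∞ ∧ ∀ Y : ℕ → Ω → ℝ, IsCoordinateVersion hW hQ Y → ∀ N,
      ∃ B : Ω → ℝ≥0∞, Measurable B ∧ ∫⁻ ω, B ω ∂μ ≤ K ∧
        ∀ ω, ∀ x ∈ D, ENNReal.ofReal (Real.exp (lam * |expansion e Y N ω x|)) ≤ B ω := by
  obtain ⟨R, hR0, hR⟩ : ∃ R : ℝ, 0 < R ∧ ∀ y ∈ D, ∀ z ∈ D, ‖y - z‖ ≤ R := by
    obtain ⟨R, hR⟩ := Metric.isBounded_iff.1 hDb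
    exact ⟨max R 1, by positivity, fun y hy z hz => by
      rw [← dist_eq_norm]; exact (hR hy hz).trans (le_max_left _ _)⟩
  set ν : Measure (Space d) := volume with hν
  have hVT : ν D ≠ ∞ := hDb.measure_lt_top.ne
  set V := (ν D).toReal with hVdef
  have hV : ν D = ENNReal.ofReal V := (ENNReal.ofReal_toReal hVT).symm
  have hV0 : 0 < V := ENNReal.toReal_pos (hDo.measure_pos ν hDn).ne' hVT
  set θ := holderExponent α β with hθ
  have hθ0 : 0 < θ := he.holderExponent_pos
  set τ := 2 * lam * R ^ θ * chainRate θ with hτ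
  set c := ENNReal.ofReal (2 * Real.exp
    (chainEntropy (Module.finrank ℝ (Space d)) θ / (2 * chainRate θ))) with hc
  set L := 4 * Ce ^ 2 * ((d : ℝ) ^ θ) ^ 2 * Cη with hL
  have hL0 : 0 ≤ L := by have := he.Cη_pos; positivity
  set K₁ := ENNReal.ofReal (2 * Real.exp ((2 * lam) ^ 2 * (Ce ^ 2 * Cη) / 2)) with hK₁
  set K₂ := ENNReal.ofReal (2 * Real.exp (τ ^ 2 * L / 2)) with hK₂
  refine ⟨c * (ENNReal.ofReal V⁻¹ * (K₁ * ν D)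
    + ENNReal.ofReal (V ^ 2)⁻¹ * (K₂ * ν D * ν D)), ?_, fun Y hY N => ?_⟩
  · finiteness
  set X := expansion (fun i => D.indicator (e i)) Y N with hXdef
  have hX : Measurable fun p : Ω × Space d => X p.1 p.2 :=
    measurable_expansion (he.measurable_indicator hDo) hY.measurable N
  have hXω : ∀ ω, Measurable (X ω) := fun ω => hX.comp measurable_prodMk_left
  have hXe : ∀ ω, ∀ x ∈ D, X ω x = expansion e Y N ω x := fun ω x hx =>
    expansion_indicator Y N ω hx
  have hm1 : Measurable fun p : Ω × Space d =>
      ENNReal.ofReal (Real.exp (2 * lam * |X p.1 p.2|)) := by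
    have : Measurable fun p : Ω × Space d => |X p.1 p.2| := hX.abs
    fun_prop
  have hm2 : Measurable fun p : (Ω × Space d) × Space d =>
      modulusKernel τ θ (X p.1.1) p.1.2 p.2 := by
    have h1 : Measurable fun p : (Ω × Space d) × Space d => X p.1.1 p.1.2 :=
      hX.comp measurable_fst
    have h2 : Measurable fun p : (Ω × Space d) × Space d => X p.1.1 p.2 :=
      hX.comp ((measurable_fst.comp measurable_fst).prodMk measurable_snd)
    have h3 : Measurable fun p : (Ω × Space d) × Space d => |X p.1.1 p.1.2 - X p.1.1 p.2| :=
      (h1.sub h2).abs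
    unfold modulusKernel
    fun_prop
  have hm2' : Measurable fun p : Ω × Space d =>
      ∫⁻ z in D, modulusKernel τ θ (X p.1) p.2 z ∂ν := hm2.lintegral_prod_right'
  have hI1 : Measurable fun ω => ∫⁻ y in D, ENNReal.ofReal (Real.exp (2 * lam * |X ω y|)) ∂ν :=
    hm1.lintegral_prod_right'
  have hI2 : Measurable fun ω => ∫⁻ y in D, ∫⁻ z in D, modulusKernel τ θ (X ω) y z ∂ν ∂ν :=
    hm2'.lintegral_prod_right'
  have hmom1 : ∀ y ∈ D, ∫⁻ ω, ENNReal.ofReal (Real.exp (2 * lam * |X ω y|)) ∂μ ≤ K₁ := by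
    intro y hy
    simp only [hXe _ y hy]
    exact lintegral_exp_mul_abs_sum_le hW hQ hY _ N (he.variance_le hQ.nonneg N hy) _
  have hmom2 : ∀ y ∈ D, ∀ z ∈ D, ∫⁻ ω, modulusKernel τ θ (X ω) y z ∂μ ≤ K₂ := by
    intro y hy z hz
    have h1 := lintegral_exp_mul_abs_sum_le hW hQ hY (fun i => e i y - e i z) N
      (he.increment_variance_le hQ.nonneg hD hDo N hy hz) (τ / ‖y - z‖ ^ θ)
    refine le_trans (le_of_eq ?_) (h1.trans (ENNReal.ofReal_le_ofReal ?_))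
    · refine lintegral_congr fun ω => ?_
      rw [modulusKernel, hXe ω y hy, hXe ω z hz, expansion, expansion, ← Finset.sum_sub_distrib]
      simp only [← sub_mul]
      congr 2; ring
    -- The squared singularity of the kernel cancels against the increment variance. If `‖y - z‖ ^ θ
    -- = 0`, the left side is `0` by the convention for division by zero.
    · have key : (τ / ‖y - z‖ ^ θ) ^ 2 * (L * (‖y - z‖ ^ θ) ^ 2) ≤ τ ^ 2 * L := by
        rcases eq_or_ne (‖y - z‖ ^ θ) 0 with h | h
        · rw [h]; simp; positivity
        · refine le_of_eq ?_
          field_simp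
      gcongr 2 * Real.exp (?_ / 2)
  refine ⟨fun ω => c * (ENNReal.ofReal V⁻¹ *
      ∫⁻ y in D, ENNReal.ofReal (Real.exp (2 * lam * |X ω y|)) ∂ν +
    ENNReal.ofReal (V ^ 2)⁻¹ * ∫⁻ y in D, ∫⁻ z in D, modulusKernel τ θ (X ω) y z ∂ν ∂ν),
    ?_, ?_, fun ω x hx => ?_⟩
  · exact ((hI1.const_mul _).add (hI2.const_mul _)).const_mul _
  · rw [lintegral_const_mul _ (by fun_prop), lintegral_add_left (hI1.const_mul _),
      lintegral_const_mul _ hI1, lintegral_const_mul _ hI2]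
    gcongr
    · exact lintegral_setLIntegral_le hm1 hmom1
    · refine lintegral_setLIntegral_le hm2' fun y hy => ?_
      have hm3 : Measurable fun p : Ω × Space d => modulusKernel τ θ (X p.1) y p.2 :=
        hm2.comp (g := fun p : (Ω × Space d) × Space d => modulusKernel τ θ (X p.1.1) p.1.2 p.2)
          (f := fun p : Ω × Space d => ((p.1, y), p.2))
          ((measurable_fst.prodMk measurable_const).prodMk measurable_snd)
      exact lintegral_setLIntegral_le hm3 (hmom2 y hy)
  · rw [← hXe ω x hx]
    have hc : ContinuousOn (X ω) D := (continuousOn_expansion he Y N ω).congr (hXe ω)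
    have h := exp_abs_le_of_modulus (f := X ω) hD hV0 hV hR0 hR hθ0 hlam (hXω ω) hc hx
    exact h

end Field

/-! ### Convergence of the truncated expansions to the field. -/

/-- Fourier expansion of an element of the closed span of an orthonormal sequence. -/
theorem tendsto_sum_inner_smul {F : Type*} [NormedAddCommGroup F] [InnerProductSpace ℝ F]
    [CompleteSpace F] {v : ℕ → F} (hv : Orthonormal ℝ v) {x : F}
    (hx : x ∈ (Submodule.span ℝ (Set.range v)).topologicalClosure) :
    Filter.Tendsto (fun N => ∑ i ∈ Finset.range N, inner ℝ (v i) x • v i) Filter.atTop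
      (nhds x) := by
  set S := (Submodule.span ℝ (Set.range v)).topologicalClosure with hS
  have hmem : ∀ i, v i ∈ S := fun i =>
    Submodule.le_topologicalClosure _ (Submodule.subset_span ⟨i, rfl⟩)
  let w : ℕ → S := fun i => ⟨v i, hmem i⟩
  have hw : Orthonormal ℝ w := by
    rw [orthonormal_iff_ite] at hv ⊢
    exact hv
  -- Inside the closed span, regarded as a Hilbert space of its own, the sequence becomes a Hilbert
  -- basis: a vector there orthogonal to every `v i` is orthogonal to itself.
  have hspan : (Submodule.span ℝ (Set.range w))ᗮ = ⊥ := by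
    rw [Submodule.eq_bot_iff]
    intro y hy
    have h1 : (y : F) ∈ (Submodule.span ℝ (Set.range v))ᗮ := by
      rw [Submodule.mem_orthogonal]
      intro u hu
      induction hu using Submodule.span_induction with
      | mem u hu =>
        obtain ⟨i, rfl⟩ := hu
        exact (Submodule.mem_orthogonal _ _).1 hy (w i) (Submodule.subset_span ⟨i, rfl⟩)
      | zero => simp
      | add u u' _ _ h h' => rw [inner_add_left, h, h', add_zero]
      | smul c u _ h => rw [inner_smul_left, h, mul_zero]
    rw [← Submodule.orthogonal_closure] at h1
    have h2 : inner ℝ (y : F) (y : F) = 0 := (Submodule.mem_orthogonal _ _).1 h1 y y.2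
    exact Subtype.ext (inner_self_eq_zero.1 h2)
  have : CompleteSpace S := (Submodule.isClosed_topologicalClosure _).completeSpace_coe
  let b := HilbertBasis.mkOfOrthogonalEqBot hw hspan
  have hb := ((b.hasSum_repr ⟨x, hx⟩).mapL S.subtypeL).tendsto_sum_nat
  refine hb.congr fun N => Finset.sum_congr rfl fun i _ => ?_
  have hbi : b i = w i := by simp [b]
  simp only [b.repr_apply_apply, hbi]
  rfl

theorem norm_sum_inner_smul_le {F : Type*} [NormedAddCommGroup F] [InnerProductSpace ℝ F]
    {v : ℕ → F} (hv : Orthonormal ℝ v) (x : F) (N : ℕ) :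
    ‖∑ i ∈ Finset.range N, inner ℝ (v i) x • v i‖ ≤ ‖x‖ := by
  refine le_of_sq_le_sq ?_ (norm_nonneg _)
  rw [← real_inner_self_eq_norm_sq, hv.inner_sum]
  refine le_trans (le_of_eq ?_) (hv.sum_inner_products_le x (s := Finset.range N))
  refine Finset.sum_congr rfl fun i _ => ?_
  rw [Real.norm_eq_abs, sq_abs, conj_trivial, sq]

section Field

variable {d : ℕ} {D : Set (Space d)} {Ω : Type*} [MeasurableSpace Ω] {μ : Measure Ω}
  {W : Ω → Space d → ℝ} {Q : H D →L[ℝ] H D} {η : ℕ → ℝ} {e : ℕ → Space d → ℝ}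
  {α β Ce Cη : ℝ}

/-- The second moment of `⟨f, W⟩` is `⟨Q f, f⟩`, and `Q f = 0` for such `f`. -/
theorem ae_inner_path_eq_zero (hW : IsCenteredGaussianField D μ W Q)
    (hQ : IsEigensystem D Q η e) {f : H D} (hf : ∀ i, inner ℝ (hQ.vec i) f = 0) :
    ∀ᵐ ω ∂μ, inner ℝ f (hW.path ω) = 0 := by
  have h0 : ∫ ω, inner ℝ f (hW.path ω) * inner ℝ f (hW.path ω) ∂μ = 0 := by
    have := hW.covariance f f
    rw [hQ.complete f hf, inner_zero_left] at this
    exact this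
  have hint : Integrable (fun ω => inner ℝ f (hW.path ω) * inner ℝ f (hW.path ω)) μ := by
    have := (hW.gaussian f).memLp_two.integrable_sq
    simp only [sq] at this
    exact this
  rw [integral_eq_zero_iff_of_nonneg (fun ω => mul_self_nonneg _) hint] at h0
  filter_upwards [h0] with ω hω
  exact mul_self_eq_zero.1 hω

/-- The exceptional null set for a single orthogonal direction depends on that direction.
Separability leaves countably many directions to test, and continuity of the inner product covers
the rest. -/
theorem ae_path_mem_closure_span (hW : IsCenteredGaussianField D μ W Q)
    (hQ : IsEigensystem D Q η e) :
    ∀ᵐ ω ∂μ, hW.path ω ∈ (Submodule.span ℝ (Set.range hQ.vec)).topologicalClosure := by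
  set S := Submodule.span ℝ (Set.range hQ.vec) with hS
  have : Fact ((2 : ℝ≥0∞) ≠ ∞) := ⟨by simp⟩
  have hsep : SecondCountableTopology (H D) := inferInstance
  have hd : ∀ n, ∀ᵐ ω ∂μ, inner ℝ ((TopologicalSpace.denseSeq Sᗮ n : Sᗮ) : H D) (hW.path ω) = 0 :=
    fun n => ae_inner_path_eq_zero hW hQ fun i =>
      (Submodule.mem_orthogonal _ _).1 (TopologicalSpace.denseSeq Sᗮ n).2 _
        (Submodule.subset_span ⟨i, rfl⟩)
  filter_upwards [ae_all_iff.2 hd] with ω hω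
  rw [← Submodule.orthogonal_orthogonal_eq_closure, Submodule.mem_orthogonal]
  intro f hf
  have hcl : IsClosed {g : Sᗮ | inner ℝ (g : H D) (hW.path ω) = 0} :=
    isClosed_eq (by fun_prop) continuous_const
  have hall := hcl.closure_subset_iff.2 (Set.range_subset_iff.2 hω)
  exact hall (TopologicalSpace.denseRange_denseSeq Sᗮ ⟨f, hf⟩)

theorem exists_isCoordinateVersion (hW : IsCenteredGaussianField D μ W Q)
    (hQ : IsEigensystem D Q η e) : ∃ Y : ℕ → Ω → ℝ, IsCoordinateVersion hW hQ Y := by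
  have hm : ∀ i, AEMeasurable (fun ω => inner ℝ (hQ.vec i) (hW.path ω)) μ := fun i =>
    (hW.gaussian (hQ.vec i)).aemeasurable
  exact ⟨fun i => (hm i).mk _, fun i => (hm i).measurable_mk, fun i => (hm i).ae_eq_mk.symm⟩

/-- The mean square truncation error of the expansion tends to zero. -/
theorem tendsto_lintegral_truncation (hW : IsCenteredGaussianField D μ W Q)
    (hQ : IsEigensystem D Q η e) :
    Filter.Tendsto (fun N => ∫⁻ ω, ‖∑ i ∈ Finset.range N,
      inner ℝ (hQ.vec i) (hW.path ω) • hQ.vec i - hW.path ω‖ₑ ^ 2 ∂μ) Filter.atTop (nhds 0) := by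
  have hv : Orthonormal ℝ hQ.vec := hQ.orthonormal
  have hm : AEStronglyMeasurable hW.path μ := hW.memLp_field.1
  rw [← lintegral_zero (μ := μ)]
  -- By Bessel's inequality the error never exceeds `2 ‖W‖`, whose square is integrable.
  refine tendsto_lintegral_of_dominated_convergence' (fun ω => (2 * ‖hW.path ω‖ₑ) ^ 2)
    (fun N => ?_) (fun N => Filter.Eventually.of_forall fun ω => ?_) ?_ ?_
  · have : AEStronglyMeasurable (fun ω => ∑ i ∈ Finset.range N,
        inner ℝ (hQ.vec i) (hW.path ω) • hQ.vec i - hW.path ω) μ := by fun_prop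
    exact this.enorm.pow_const 2
  · have h1 : ‖∑ i ∈ Finset.range N, inner ℝ (hQ.vec i) (hW.path ω) • hQ.vec i - hW.path ω‖ₑ
        ≤ 2 * ‖hW.path ω‖ₑ := by
      refine enorm_sub_le.trans ?_
      rw [two_mul]
      gcongr
      exact enorm_le_iff_norm_le.2 (norm_sum_inner_smul_le hv _ N)
    exact pow_le_pow_left' h1 2
  · simp only [mul_pow]
    have hm2 : AEMeasurable (fun ω => ‖hW.path ω‖ₑ ^ 2) μ := hm.enorm.pow_const 2
    rw [lintegral_const_mul'' _ hm2]
    refine ENNReal.mul_ne_top (by finiteness) ?_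
    have := hW.memLp_field.eLpNorm_lt_top
    have h2 := lintegral_rpow_enorm_lt_top_of_eLpNorm_lt_top (by simp) (by simp) this
    simp only [ENNReal.toReal_ofNat, ENNReal.rpow_ofNat] at h2
    exact h2.ne
  · filter_upwards [ae_path_mem_closure_span hW hQ] with ω hω
    have h1 := (tendsto_sum_inner_smul hv hω).sub_const (hW.path ω)
    rw [sub_self] at h1
    have h2 := (ENNReal.continuous_pow 2).tendsto _ |>.comp h1.enorm
    simp only [enorm_zero, ne_eq, OfNat.ofNat_ne_zero, not_false_eq_true, zero_pow] at h2
    exact h2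

/-- The truncation error in `H` as an integral over `D`. -/
theorem ae_lintegral_expansion_sub (hW : IsCenteredGaussianField D μ W Q)
    (hQ : IsEigensystem D Q η e) {Y : ℕ → Ω → ℝ} (hY : IsCoordinateVersion hW hQ Y) (N : ℕ) :
    ∀ᵐ ω ∂μ, ∫⁻ x in D, ‖expansion e Y N ω x - W ω x‖ₑ ^ 2 =
      ‖∑ i ∈ Finset.range N, inner ℝ (hQ.vec i) (hW.path ω) • hQ.vec i - hW.path ω‖ₑ ^ 2 := by
  filter_upwards [ae_all_iff.2 hY.coord] with ω hω
  have h1 : ∀ᵐ x ∂(volume.restrict D), (∑ i ∈ Finset.range N,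
      inner ℝ (hQ.vec i) (hW.path ω) • hQ.vec i - hW.path ω : H D) x
        = expansion e Y N ω x - W ω x := by
    have hc : ∀ i, ∀ᵐ x ∂(volume.restrict D),
        (inner ℝ (hQ.vec i) (hW.path ω) • hQ.vec i : H D) x = Y i ω * e i x := fun i => by
      filter_upwards [Lp.coeFn_smul (inner ℝ (hQ.vec i) (hW.path ω)) (hQ.vec i),
        (hQ.memLp i).coeFn_toLp] with x h1 h2
      rw [h1, Pi.smul_apply, smul_eq_mul, ← hω i, IsEigensystem.vec, h2]
    filter_upwards [Lp.coeFn_sub (∑ i ∈ Finset.range N,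
      inner ℝ (hQ.vec i) (hW.path ω) • hQ.vec i) (hW.path ω), (hW.memLp_path ω).coeFn_toLp,
      Lp.coeFn_finsetSum (Finset.range N)
        (fun i => inner ℝ (hQ.vec i) (hW.path ω) • hQ.vec i), ae_all_iff.2 hc] with x h1 h2 h3 h4
    rw [h1, Pi.sub_apply, h3, IsCenteredGaussianField.path, h2, expansion, Finset.sum_apply]
    congr 1
    exact Finset.sum_congr rfl fun i _ => (h4 i).trans (mul_comm _ _)
  rw [Lp.enorm_def, eLpNorm_eq_lintegral_rpow_enorm_toReal (by simp) (by simp)]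
  simp only [ENNReal.toReal_ofNat]
  rw [← ENNReal.rpow_natCast, ← ENNReal.rpow_mul]
  simp only [Nat.cast_ofNat, one_div, ne_eq, OfNat.ofNat_ne_zero, not_false_eq_true,
    inv_mul_cancel₀, ENNReal.rpow_one]
  refine lintegral_congr_ae ?_
  filter_upwards [h1] with x hx
  rw [hx, ← ENNReal.rpow_natCast, Nat.cast_ofNat]

/-- Along a sequence of truncation levels the expansions converge to the field almost
everywhere. -/
theorem exists_ae_tendsto_expansion (hDo : IsOpen D) (hW : IsCenteredGaussianField D μ W Q)
    (hQ : IsEigensystem D Q η e) (he : EigenBounds D η e α β Ce Cη) {Y : ℕ → Ω → ℝ}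
    (hY : IsCoordinateVersion hW hQ Y) :
    ∃ ns : ℕ → ℕ, ∀ᵐ ω ∂μ, ∀ᵐ x ∂(volume.restrict D),
      Filter.Tendsto (fun k => expansion e Y (ns k) ω x) Filter.atTop (nhds (W ω x)) := by
  -- Truncation levels with summable mean square errors: the sum of the squared errors is then
  -- finite almost surely, and by a second application over `D` finite at almost every `x`, so its
  -- terms tend to zero.
  have hns : ∀ k : ℕ, ∃ n, ∫⁻ ω, ‖∑ i ∈ Finset.range n,
      inner ℝ (hQ.vec i) (hW.path ω) • hQ.vec i - hW.path ω‖ₑ ^ 2 ∂μ ≤ (2 : ℝ≥0∞)⁻¹ ^ k :=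
    fun k => ((tendsto_lintegral_truncation hW hQ).eventually
      (ge_mem_nhds (ENNReal.pow_pos (by simp) k))).exists
  choose ns hns using hns
  refine ⟨ns, ?_⟩
  have hm : AEStronglyMeasurable hW.path μ := hW.memLp_field.1
  have hfin : ∀ᵐ ω ∂μ, ∑' k, ‖∑ i ∈ Finset.range (ns k),
      inner ℝ (hQ.vec i) (hW.path ω) • hQ.vec i - hW.path ω‖ₑ ^ 2 < ∞ := by
    have hmk : ∀ k, AEMeasurable (fun ω => ‖∑ i ∈ Finset.range (ns k),
        inner ℝ (hQ.vec i) (hW.path ω) • hQ.vec i - hW.path ω‖ₑ ^ 2) μ := fun k => by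
      have : AEStronglyMeasurable (fun ω => ∑ i ∈ Finset.range (ns k),
        inner ℝ (hQ.vec i) (hW.path ω) • hQ.vec i - hW.path ω) μ := by fun_prop
      exact this.enorm.pow_const 2
    refine ae_lt_top' (AEMeasurable.tsum hmk) ?_
    rw [lintegral_tsum hmk]
    refine ((ENNReal.tsum_le_tsum hns).trans_lt ?_).ne
    rw [ENNReal.tsum_geometric]
    simp
  filter_upwards [hfin, ae_all_iff.2 fun k => ae_lintegral_expansion_sub hW hQ hY (ns k)]
    with ω hω hk
  have hmx : ∀ k, AEMeasurable (fun x => ‖expansion e Y (ns k) ω x - W ω x‖ₑ ^ 2)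
      (volume.restrict D) := fun k => by
    have h1 : AEStronglyMeasurable (expansion e Y (ns k) ω) (volume.restrict D) :=
      (continuousOn_expansion he Y (ns k) ω).aestronglyMeasurable hDo.measurableSet
    exact (h1.sub (hW.memLp_path ω).1).enorm.pow_const 2
  have hfx : ∀ᵐ x ∂(volume.restrict D), ∑' k, ‖expansion e Y (ns k) ω x - W ω x‖ₑ ^ 2 < ∞ := by
    refine ae_lt_top' (AEMeasurable.tsum hmx) ?_
    rw [lintegral_tsum hmx]
    simp only [hk]
    exact hω.ne
  filter_upwards [hfx] with x hx
  have h0 := ENNReal.tendsto_atTop_zero_of_tsum_ne_top hx.ne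
  rw [tendsto_iff_edist_tendsto_0]
  have h1 := (ENNReal.continuous_rpow_const (y := (2 : ℝ)⁻¹)).tendsto _ |>.comp h0
  rw [ENNReal.zero_rpow_of_pos (by norm_num)] at h1
  refine h1.congr fun k => ?_
  rw [Function.comp_apply, ← ENNReal.rpow_natCast, ← ENNReal.rpow_mul, edist_eq_enorm_sub]
  norm_num

/-- A field has a jointly measurable version on `D`. -/
def HasMeasurableVersion (D : Set (Space d)) (μ : Measure Ω) (X : Ω → Space d → ℝ) : Prop :=
  ∃ V : Ω → Space d → ℝ, (Measurable fun p : Ω × Space d => V p.1 p.2) ∧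
    ∀ᵐ ω ∂μ, ∀ᵐ x ∂(volume.restrict D), X ω x = V ω x

/-- The exponential of a field is dominated by a random variable of expectation at most `K`. -/
def IsDominatedField (D : Set (Space d)) (μ : Measure Ω) (lam : ℝ) (K : ℝ≥0∞)
    (X : Ω → Space d → ℝ) : Prop :=
  ∃ B : Ω → ℝ≥0∞, Measurable B ∧ ∫⁻ ω, B ω ∂μ ≤ K ∧
    ∀ᵐ ω ∂μ, ∀ᵐ x ∂(volume.restrict D), ENNReal.ofReal (Real.exp (lam * |X ω x|)) ≤ B ω

theorem hasMeasurableVersion_expansion (hDo : IsOpen D) (he : EigenBounds D η e α β Ce Cη)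
    {Y : ℕ → Ω → ℝ} (hY : ∀ i, Measurable (Y i)) (N : ℕ) :
    HasMeasurableVersion D μ (expansion e Y N) :=
  ⟨_, measurable_expansion (he.measurable_indicator hDo) hY N,
    Filter.Eventually.of_forall fun ω => (ae_restrict_mem hDo.measurableSet).mono fun _ hx =>
      (expansion_indicator Y N ω hx).symm⟩

/-- The definition of the field gives no joint measurability in `(ω, x)`. The limsup of jointly
measurable expansions has it, and agrees with `W` wherever the subsequence converges. -/
theorem hasMeasurableVersion_field (hDo : IsOpen D) (hW : IsCenteredGaussianField D μ W Q)
    (hQ : IsEigensystem D Q η e) (he : EigenBounds D η e α β Ce Cη) :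
    HasMeasurableVersion D μ W := by
  obtain ⟨Y, hY⟩ := exists_isCoordinateVersion hW hQ
  obtain ⟨ns, hns⟩ := exists_ae_tendsto_expansion hDo hW hQ he hY
  refine ⟨fun ω x => Filter.limsup
    (fun k => expansion (fun i => D.indicator (e i)) Y (ns k) ω x) Filter.atTop,
    Measurable.limsup fun k =>
      measurable_expansion (he.measurable_indicator hDo) hY.measurable (ns k), ?_⟩
  filter_upwards [hns] with ω hω
  filter_upwards [hω, ae_restrict_mem hDo.measurableSet] with x hx hxD
  simp only [expansion_indicator Y _ ω hxD]
  exact hx.limsup_eq.symm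

/-- The truncations share one constant `K`, so by Fatou the liminf of their dominating variables has
expectation at most `K` and dominates the a.e. limit `W`. -/
theorem exists_isDominatedField [IsProbabilityMeasure μ] (hD : Convex ℝ D) (hDo : IsOpen D)
    (hDb : Bornology.IsBounded D) (hDn : D.Nonempty)
    (hW : IsCenteredGaussianField D μ W Q) (hQ : IsEigensystem D Q η e)
    (he : EigenBounds D η e α β Ce Cη) {lam : ℝ} (hlam : 0 < lam) :
    ∃ K : ℝ≥0∞, K ≠ ∞ ∧ IsDominatedField D μ lam K W ∧
      ∀ Y : ℕ → Ω → ℝ, IsCoordinateVersion hW hQ Y → ∀ N,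
        IsDominatedField D μ lam K (expansion e Y N) := by
  obtain ⟨K, hK, hdom⟩ := exists_dominating hD hDo hDb hDn hW hQ he hlam
  refine ⟨K, hK, ?_, fun Y hY N => ?_⟩
  · obtain ⟨Y, hY⟩ := exists_isCoordinateVersion hW hQ
    obtain ⟨ns, hns⟩ := exists_ae_tendsto_expansion hDo hW hQ he hY
    choose B hBm hBK hB using fun k => hdom Y hY (ns k)
    refine ⟨fun ω => Filter.liminf (fun k => B k ω) Filter.atTop, Measurable.liminf hBm, ?_, ?_⟩
    · refine (lintegral_liminf_le hBm).trans ?_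
      refine (Filter.liminf_le_liminf (Filter.Eventually.of_forall hBK)).trans_eq ?_
      exact Filter.liminf_const K
    · filter_upwards [hns] with ω hω
      filter_upwards [hω, ae_restrict_mem hDo.measurableSet] with x hx hxD
      have ht : Filter.Tendsto (fun k => ENNReal.ofReal (Real.exp
          (lam * |expansion e Y (ns k) ω x|))) Filter.atTop
          (nhds (ENNReal.ofReal (Real.exp (lam * |W ω x|)))) :=
        (ENNReal.continuous_ofReal.comp (Real.continuous_exp.comp
          (continuous_const.mul continuous_abs))).continuousAt.tendsto.comp hx
      rw [← ht.liminf_eq]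
      exact Filter.liminf_le_liminf (Filter.Eventually.of_forall fun k => hB k ω x hxD)
  · obtain ⟨B, hBm, hBK, hB⟩ := hdom Y hY N
    exact ⟨B, hBm, hBK, Filter.Eventually.of_forall fun ω =>
      (ae_restrict_mem hDo.measurableSet).mono fun x hx => hB ω x hx⟩

end Field

/-! ### From bounds on the field to bounds on the coefficients. -/

section Coefficients

variable {d : ℕ} {D : Set (Space d)} {Ω : Type*} [MeasurableSpace Ω] {μ : Measure Ω}
  {abar : Space d → ℝ} {A : ℝ} {Φ : ℝ → ℝ} {φ₁ φ₂ φ₃ φ₄ : ℝ} {X : Ω → Space d → ℝ}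
  {τ : Ω → ℕ} {T : ℕ → Ω → Set (Space d)} {J : ℕ → Ω → ℝ} {Pbar : ℝ}

theorem jumpPart_nonneg (hJ : IsJumpSequence J Pbar) (ω : Ω) (x : Space d) :
    0 ≤ jumpPart τ T J ω x :=
  Finset.sum_nonneg fun i _ => Set.indicator_nonneg (fun _ _ => hJ.nonneg i ω) x

/-- Disjointness leaves at most one nonzero summand, and none at points outside all the pieces. -/
theorem jumpPart_le (hT : IsRandomPartition D τ T) (hP : 0 ≤ Pbar) (hJ : IsJumpSequence J Pbar)
    (ω : Ω) (x : Space d) : jumpPart τ T J ω x ≤ Pbar := by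
  by_cases h : ∃ i < τ ω, x ∈ T i ω
  · obtain ⟨i, hi, hx⟩ := h
    rw [jumpPart, Finset.sum_eq_single_of_mem i (Finset.mem_range.2 hi), Set.indicator_of_mem hx]
    · exact hJ.le i ω
    · intro j hj hji
      refine Set.indicator_of_notMem (fun hxj => ?_) _
      exact Set.disjoint_left.1 (hT.disjoint ω j (Finset.mem_range.1 hj) i hi hji) hxj hx
  · push Not at h
    rw [jumpPart, Finset.sum_eq_zero]
    · exact hP
    · exact fun i hi => Set.indicator_of_notMem (h i (Finset.mem_range.1 hi)) _

theorem measurable_jumpPart (hT : IsRandomPartition D τ T) (hJ : IsJumpSequence J Pbar) :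
    Measurable fun p : Ω × Space d => jumpPart τ T J p.1 p.2 := by
  set S : ℕ → Set (Ω × Space d) := fun i => {p | i < τ p.1 ∧ p.2 ∈ T i p.1} with hS
  -- The random number of summands is decoupled into a separate discrete variable, measurability is
  -- checked for each fixed value, and `τ` is substituted afterwards.
  have hg : Measurable fun r : (Ω × Space d) × ℕ =>
      ∑ i ∈ Finset.range r.2, (S i).indicator (fun p => J i p.1) r.1 := by
    refine measurable_from_prod_countable_left fun n => ?_
    exact Finset.measurable_sum (f := fun i => (S i).indicator fun p => J i p.1) (Finset.range n)
      fun i _ => ((hJ.measurable i).comp measurable_fst).indicator (hT.measurable_graph i)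
  have hτ : Measurable fun p : Ω × Space d => (p, τ p.1) :=
    measurable_id.prodMk (hT.measurable_card.comp measurable_fst)
  convert hg.comp hτ using 1
  ext p
  refine Finset.sum_congr rfl fun i hi => ?_
  by_cases hp : p.2 ∈ T i p.1
  · rw [Set.indicator_of_mem hp, Set.indicator_of_mem (show p ∈ S i from
      ⟨Finset.mem_range.1 hi, hp⟩)]
  · rw [Set.indicator_of_notMem hp, Set.indicator_of_notMem fun h => hp h.2]

theorem coeffMeasurable_diffusionCoeff (hΦ : IsLinkFunction Φ φ₁ φ₂ φ₃ φ₄)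
    (hT : IsRandomPartition D τ T) (hJ : IsJumpSequence J Pbar)
    (hX : ∀ x ∈ D, Measurable fun ω => X ω x) (b₁ b₂ : Space d → Fin d → ℝ) :
    CoeffMeasurable D (diffusionCoeff abar Φ X τ T J)
      (advectionCoeff (diffusionCoeff abar Φ X τ T J) b₁ b₂) := by
  intro x hx
  have hj : Measurable fun ω => jumpPart τ T J ω x :=
    (measurable_jumpPart hT hJ).comp measurable_prodMk_right
  have ha : Measurable fun ω => diffusionCoeff abar Φ X τ T J ω x :=
    (measurable_const.add (hΦ.contDiff.continuous.measurable.comp (hX x hx))).add hj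
  exact ⟨ha, measurable_pi_lambda _ fun j => (ha.mul_const _).min measurable_const⟩

theorem hasMeasurableVersion_diffusionCoeff (hDo : IsOpen D) (habar : IsMeanCoefficient D abar A)
    (hΦ : IsLinkFunction Φ φ₁ φ₂ φ₃ φ₄) (hT : IsRandomPartition D τ T)
    (hJ : IsJumpSequence J Pbar) (hX : HasMeasurableVersion D μ X) :
    HasMeasurableVersion D μ (diffusionCoeff abar Φ X τ T J) := by
  classical
  obtain ⟨V, hV, hXV⟩ := hX
  have hab : Measurable (D.indicator abar) := by
    rw [← Set.piecewise_eq_indicator]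
    exact (habar.contDiffOn.continuousOn.mono subset_closure).measurable_piecewise
      continuousOn_const hDo.measurableSet
  refine ⟨fun ω x => D.indicator abar x + Φ (V ω x) + jumpPart τ T J ω x,
    ((hab.comp measurable_snd).add (hΦ.contDiff.continuous.measurable.comp hV)).add
      (measurable_jumpPart hT hJ), ?_⟩
  filter_upwards [hXV] with ω hω
  filter_upwards [hω, ae_restrict_mem hDo.measurableSet] with x hx hxD
  rw [diffusionCoeff, hx, Set.indicator_of_mem hxD]

/-- For a jointly measurable version, the essential supremum is at most `c` exactly when the section
`{x : V ω x > c}` is null in `D`, and the measure of a section depends measurably on `ω`. -/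
theorem aemeasurable_essSupOn {a : Ω → Space d → ℝ} (ha : HasMeasurableVersion D μ a) :
    AEMeasurable (essSupOn D a) μ := by
  obtain ⟨V, hV, haV⟩ := ha
  refine ⟨essSupOn D V, measurable_of_Iic fun c => ?_, ?_⟩
  · have hs : MeasurableSet {p : Ω × Space d | ¬ ((V p.1 p.2 : ℝ) : EReal) ≤ c} :=
      (measurableSet_le hV.coe_real_ereal measurable_const).compl
    convert measurable_measure_prodMk_left (ν := (volume : Measure (Space d)).restrict D) hs
      (measurableSet_singleton 0) using 1
    ext ω
    have : ω ∈ essSupOn D V ⁻¹' Set.Iic c ↔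
        ∀ᵐ x ∂(volume.restrict D), ((V ω x : ℝ) : EReal) ≤ c :=
      ⟨fun h => (ae_le_essSup (by isBoundedDefault)).mono fun x hx => hx.trans h,
        fun h => essSup_le_of_ae_le _ h⟩
    rw [this, ae_iff]
    rfl
  · filter_upwards [haV] with ω hω
    exact essSup_congr_ae (hω.mono fun x hx => by simp only [hx])

theorem aemeasurable_essInfOn {a : Ω → Space d → ℝ} (ha : HasMeasurableVersion D μ a) :
    AEMeasurable (essInfOn D a) μ := by
  obtain ⟨V, hV, haV⟩ := ha
  refine ⟨essInfOn D V, measurable_of_Ici fun c => ?_, ?_⟩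
  · have hs : MeasurableSet {p : Ω × Space d | ¬ c ≤ ((V p.1 p.2 : ℝ) : EReal)} :=
      (measurableSet_le measurable_const hV.coe_real_ereal).compl
    convert measurable_measure_prodMk_left (ν := (volume : Measure (Space d)).restrict D) hs
      (measurableSet_singleton 0) using 1
    ext ω
    have : ω ∈ essInfOn D V ⁻¹' Set.Ici c ↔
        ∀ᵐ x ∂(volume.restrict D), c ≤ ((V ω x : ℝ) : EReal) :=
      ⟨fun h => (ae_essInf_le (by isBoundedDefault)).mono fun x hx => le_trans h hx,
        fun h => le_essInf_of_ae_le _ h⟩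
    rw [this, ae_iff]
    rfl
  · filter_upwards [haV] with ω hω
    exact essInf_congr_ae (hω.mono fun x hx => by simp only [hx])

/-- Deterministic two-sided bounds for the coefficient in terms of a bound for the field. -/
theorem essInfOn_essSupOn_bounds (hDo : IsOpen D) (habar : IsMeanCoefficient D abar A)
    (hΦ : IsLinkFunction Φ φ₁ φ₂ φ₃ φ₄) (hT : IsRandomPartition D τ T) (hP : 0 ≤ Pbar)
    (hJ : IsJumpSequence J Pbar) {ω : Ω} {m : ℝ}
    (hm : ∀ᵐ x ∂(volume.restrict D), |X ω x| ≤ m) :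
    ((φ₁ * Real.exp (-φ₂ * m) : ℝ) : EReal) ≤ essInfOn D (diffusionCoeff abar Φ X τ T J) ω ∧
      essSupOn D (diffusionCoeff abar Φ X τ T J) ω ≤
        ((A + φ₁ * Real.exp (φ₂ * m) + Pbar : ℝ) : EReal) := by
  have h1 := hΦ.φ₁_pos
  have h2 := hΦ.φ₂_pos
  constructor
  · refine le_essInf_of_ae_le _ ?_
    filter_upwards [hm, ae_restrict_mem hDo.measurableSet] with x hx hxD
    rw [EReal.coe_le_coe_iff, diffusionCoeff]
    have h3 := habar.nonneg x (subset_closure hxD)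
    have h4 := jumpPart_nonneg (τ := τ) (T := T) hJ ω x
    have h5 : φ₁ * Real.exp (-φ₂ * m) ≤ φ₁ * Real.exp (-φ₂ * |X ω x|) := by
      gcongr φ₁ * Real.exp ?_
      nlinarith
    linarith [hΦ.lower (X ω x)]
  · refine essSup_le_of_ae_le _ ?_
    filter_upwards [hm, ae_restrict_mem hDo.measurableSet] with x hx hxD
    rw [EReal.coe_le_coe_iff, diffusionCoeff]
    have h3 := habar.le x (subset_closure hxD)
    have h4 := jumpPart_le hT hP hJ ω x
    have h5 : φ₁ * Real.exp (φ₂ * |X ω x|) ≤ φ₁ * Real.exp (φ₂ * m) := by gcongr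
    linarith [hΦ.upper (X ω x)]

theorem coeffBounded_of_bound (hDo : IsOpen D) (habar : IsMeanCoefficient D abar A)
    (hΦ : IsLinkFunction Φ φ₁ φ₂ φ₃ φ₄) (hT : IsRandomPartition D τ T) (hP : 0 ≤ Pbar)
    (hJ : IsJumpSequence J Pbar) {ω : Ω} {m : ℝ}
    (hm : ∀ᵐ x ∂(volume.restrict D), |X ω x| ≤ m) :
    CoeffBounded D (diffusionCoeff abar Φ X τ T J) ω := by
  obtain ⟨h1, h2⟩ := essInfOn_essSupOn_bounds hDo habar hΦ hT hP hJ hm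
  have := hΦ.φ₁_pos
  refine ⟨lt_of_lt_of_le ?_ h1, h2.trans_lt (EReal.coe_lt_top _)⟩
  rw [EReal.coe_pos]
  positivity

theorem toReal_bounds (hDo : IsOpen D) (hDn : D.Nonempty) (habar : IsMeanCoefficient D abar A)
    (hΦ : IsLinkFunction Φ φ₁ φ₂ φ₃ φ₄) (hT : IsRandomPartition D τ T) (hP : 0 ≤ Pbar)
    (hJ : IsJumpSequence J Pbar) {ω : Ω} {m : ℝ}
    (hm : ∀ᵐ x ∂(volume.restrict D), |X ω x| ≤ m) :
    ‖1 / (essInfOn D (diffusionCoeff abar Φ X τ T J) ω).toReal‖ ≤ φ₁⁻¹ * Real.exp (φ₂ * m) ∧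
      ‖(essSupOn D (diffusionCoeff abar Φ X τ T J) ω).toReal‖ ≤
        A + Pbar + φ₁ * Real.exp (φ₂ * m) := by
  obtain ⟨h1, h2⟩ := essInfOn_essSupOn_bounds hDo habar hΦ hT hP hJ hm
  set i := essInfOn D (diffusionCoeff abar Φ X τ T J) ω with hi
  set s := essSupOn D (diffusionCoeff abar Φ X τ T J) ω with hs
  have hφ := hΦ.φ₁_pos
  have hpos : 0 < φ₁ * Real.exp (-φ₂ * m) := by positivity
  have : (ae (volume.restrict D)).NeBot := by
    rw [ae_neBot, ne_eq, Measure.restrict_eq_zero]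
    exact (hDo.measure_pos volume hDn).ne'
  -- This needs `D` to have positive measure. Together with the outer bounds it makes both
  -- quantities finite, so that `toReal` does not replace an infinite value by `0`.
  have his : i ≤ s := by
    obtain ⟨x, hx1, hx2⟩ := ((ae_essInf_le (μ := volume.restrict D)
      (f := fun x => ((diffusionCoeff abar Φ X τ T J ω x : ℝ) : EReal)) (by isBoundedDefault)).and
      (ae_le_essSup (μ := volume.restrict D)
        (f := fun x => ((diffusionCoeff abar Φ X τ T J ω x : ℝ) : EReal))
        (by isBoundedDefault))).exists
    exact le_trans hx1 hx2
  have hiT : i ≠ ⊤ := ((his.trans h2).trans_lt (EReal.coe_lt_top _)).ne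
  have hiB : i ≠ ⊥ := ((EReal.bot_lt_coe _).trans_le h1).ne'
  have hsT : s ≠ ⊤ := (h2.trans_lt (EReal.coe_lt_top _)).ne
  have hsB : s ≠ ⊥ := ((EReal.bot_lt_coe _).trans_le (h1.trans his)).ne'
  have hil : φ₁ * Real.exp (-φ₂ * m) ≤ i.toReal := by
    rwa [← EReal.coe_le_coe_iff, EReal.coe_toReal hiT hiB]
  have hsu : s.toReal ≤ A + φ₁ * Real.exp (φ₂ * m) + Pbar := by
    rwa [← EReal.coe_le_coe_iff, EReal.coe_toReal hsT hsB]
  have hs0 : 0 ≤ s.toReal := (hpos.le.trans hil).trans (EReal.toReal_le_toReal his hiB hsT)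
  constructor
  · rw [Real.norm_of_nonneg (by have := hpos.le.trans hil; positivity)]
    refine (one_div_le_one_div_of_le hpos hil).trans_eq ?_
    rw [neg_mul, Real.exp_neg]
    field_simp
  · rw [Real.norm_of_nonneg hs0]; linarith

/-- The norm of a root of a random variable with bounded expectation. -/
theorem eLpNorm_toReal_rpow_le {B : Ω → ℝ≥0∞} {K : ℝ≥0∞} (hBK : ∫⁻ ω, B ω ∂μ ≤ K) {q : ℝ≥0∞}
    (hq1 : 1 ≤ q) (hqT : q ≠ ∞) :
    eLpNorm (fun ω => (B ω).toReal ^ (1 / q.toReal)) q μ ≤ K ^ (1 / q.toReal) := by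
  have hq0 : 0 < q.toReal := ENNReal.toReal_pos (zero_lt_one.trans_le hq1).ne' hqT
  rw [eLpNorm_eq_lintegral_rpow_enorm_toReal (zero_lt_one.trans_le hq1).ne' hqT]
  gcongr
  refine (lintegral_mono fun ω => ?_).trans hBK
  rw [Real.enorm_of_nonneg (by positivity), ENNReal.ofReal_rpow_of_nonneg (by positivity) hq0.le,
    ← Real.rpow_mul ENNReal.toReal_nonneg, one_div_mul_cancel hq0.ne', Real.rpow_one]
  exact ENNReal.ofReal_toReal_le

omit [MeasurableSpace Ω] in
theorem ae_abs_le_of_exp_le {lam : ℝ} (hlam : 0 < lam) {B : Ω → ℝ≥0∞}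
    {ω : Ω} (hBT : B ω < ∞)
    (hB : ∀ᵐ x ∂(volume.restrict D), ENNReal.ofReal (Real.exp (lam * |X ω x|)) ≤ B ω) :
    ∀ᵐ x ∂(volume.restrict D), |X ω x| ≤ Real.log (B ω).toReal / lam := by
  filter_upwards [hB] with x hx
  rw [ENNReal.ofReal_le_iff_le_toReal hBT.ne] at hx
  rw [le_div_iff₀ hlam, mul_comm, Real.le_log_iff_exp_le ((Real.exp_pos _).trans_le hx)]
  exact hx

theorem ae_coeffBounded (hDo : IsOpen D) (habar : IsMeanCoefficient D abar A)
    (hΦ : IsLinkFunction Φ φ₁ φ₂ φ₃ φ₄) (hT : IsRandomPartition D τ T) (hP : 0 ≤ Pbar)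
    (hJ : IsJumpSequence J Pbar) {lam : ℝ} (hlam : 0 < lam) {K : ℝ≥0∞} (hK : K ≠ ∞)
    (hX : IsDominatedField D μ lam K X) :
    ∀ᵐ ω ∂μ, CoeffBounded D (diffusionCoeff abar Φ X τ T J) ω := by
  obtain ⟨B, hBm, hBK, hB⟩ := hX
  filter_upwards [ae_lt_top hBm (hBK.trans_lt hK.lt_top).ne, hB] with ω h1 h2
  exact coeffBounded_of_bound hDo habar hΦ hT hP hJ (ae_abs_le_of_exp_le hlam h1 h2)

theorem inLqWithBound_coeff [IsProbabilityMeasure μ] (hDo : IsOpen D) (hDn : D.Nonempty)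
    (habar : IsMeanCoefficient D abar A) (hΦ : IsLinkFunction Φ φ₁ φ₂ φ₃ φ₄)
    (hT : IsRandomPartition D τ T) (hP : 0 ≤ Pbar) (hJ : IsJumpSequence J Pbar)
    (hXm : HasMeasurableVersion D μ X) {q : ℝ≥0∞} (hq1 : 1 ≤ q) (hqT : q ≠ ∞) {K : ℝ≥0∞}
    (hK : K ≠ ∞) (hX : IsDominatedField D μ (q.toReal * φ₂) K X) {C : ℝ} (hC0 : 0 ≤ C)
    (hC : ENNReal.ofReal (max φ₁ φ₁⁻¹) * K ^ (1 / q.toReal) ≤ ENNReal.ofReal C) :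
    InLqWithBound μ q
        (fun ω => 1 / (essInfOn D (diffusionCoeff abar Φ X τ T J) ω).toReal) C ∧
      InLqWithBound μ q
        (fun ω => (essSupOn D (diffusionCoeff abar Φ X τ T J) ω).toReal) (A + C + Pbar) := by
  obtain ⟨B, hBm, hBK, hB⟩ := hX
  have hφ := hΦ.φ₁_pos
  have hφ2 := hΦ.φ₂_pos
  have hq0 : 0 < q.toReal := ENNReal.toReal_pos (zero_lt_one.trans_le hq1).ne' hqT
  have hver := hasMeasurableVersion_diffusionCoeff hDo habar hΦ hT hJ hXm
  have hA : 0 ≤ A := by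
    obtain ⟨x, hx⟩ := hDn
    exact (habar.nonneg x (subset_closure hx)).trans (habar.le x (subset_closure hx))
  set M : Ω → ℝ := fun ω => (B ω).toReal ^ (1 / q.toReal) with hM
  have hMm : AEStronglyMeasurable M μ := by
    have : Measurable M := by fun_prop
    exact this.aestronglyMeasurable
  have hMK : eLpNorm M q μ ≤ K ^ (1 / q.toReal) := eLpNorm_toReal_rpow_le hBK hq1 hqT
  have hbd : ∀ c : ℝ, 0 < c → c ≤ max φ₁ φ₁⁻¹ →
      eLpNorm (fun ω => c * M ω) q μ ≤ ENNReal.ofReal C := by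
    intro c hc hcm
    have := eLpNorm_const_smul (c := c) (f := M) (p := q) (μ := μ)
    refine this.trans_le (le_trans ?_ hC)
    rw [Real.enorm_of_nonneg hc.le]
    gcongr
  have hae : ∀ᵐ ω ∂μ,
      ‖1 / (essInfOn D (diffusionCoeff abar Φ X τ T J) ω).toReal‖ ≤ φ₁⁻¹ * M ω ∧
      ‖(essSupOn D (diffusionCoeff abar Φ X τ T J) ω).toReal‖ ≤ A + Pbar + φ₁ * M ω := by
    have hDv : (ae (volume.restrict D)).NeBot := by
      rw [ae_neBot, ne_eq, Measure.restrict_eq_zero]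
      exact (hDo.measure_pos volume hDn).ne'
    filter_upwards [ae_lt_top hBm (hBK.trans_lt hK.lt_top).ne, hB] with ω h1 h2
    have h3 := toReal_bounds hDo hDn habar hΦ hT hP hJ
      (ae_abs_le_of_exp_le (by positivity) h1 h2)
    have hpos : 0 < (B ω).toReal := by
      obtain ⟨x, hx⟩ := h2.exists
      exact (Real.exp_pos _).trans_le ((ENNReal.ofReal_le_iff_le_toReal h1.ne).1 hx)
    -- With `lam = q φ₂` the pathwise bound is `m = log B / (q φ₂)`, so `exp(φ₂ m)` is the `q`-th
    -- root of `B`; its `L^q` norm is therefore controlled by the expectation of `B`.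
    have h4 : Real.exp (φ₂ * (Real.log (B ω).toReal / (q.toReal * φ₂))) = M ω := by
      rw [hM]
      simp only
      rw [Real.rpow_def_of_pos hpos]
      congr 1
      field_simp
    rwa [h4] at h3
  have hinf : eLpNorm (fun ω => 1 / (essInfOn D (diffusionCoeff abar Φ X τ T J) ω).toReal) q μ
      ≤ ENNReal.ofReal C :=
    (eLpNorm_mono_ae_real (hae.mono fun ω h => h.1)).trans
      (hbd _ (inv_pos.2 hφ) (le_max_right _ _))
  have hsup : eLpNorm (fun ω => (essSupOn D (diffusionCoeff abar Φ X τ T J) ω).toReal) q μ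
      ≤ ENNReal.ofReal (A + C + Pbar) := by
    refine (eLpNorm_mono_ae_real (hae.mono fun ω h => h.2)).trans ?_
    refine (eLpNorm_add_le aestronglyMeasurable_const (hMm.const_mul φ₁) hq1).trans ?_
    have hc : eLpNorm (fun _ : Ω => A + Pbar) q μ = ENNReal.ofReal (A + Pbar) := by
      rw [eLpNorm_const _ (zero_lt_one.trans_le hq1).ne' (IsProbabilityMeasure.ne_zero μ),
        Real.enorm_of_nonneg (by positivity)]
      simp
    rw [hc]
    refine (add_le_add_right (hbd _ hφ (le_max_left _ _)) _).trans_eq ?_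
    rw [← ENNReal.ofReal_add (by positivity) hC0]
    congr 1; ring
  have hm1 := (aemeasurable_essInfOn hver).ereal_toReal
  have hm2 := (aemeasurable_essSupOn hver).ereal_toReal
  exact ⟨⟨⟨(hm1.const_div 1).aestronglyMeasurable, hinf.trans_lt ENNReal.ofReal_lt_top⟩, hinf⟩,
    ⟨⟨hm2.aestronglyMeasurable, hsup.trans_lt ENNReal.ofReal_lt_top⟩, hsup⟩⟩

end Coefficients

/-! ### Change on a null set, Karhunen–Loève coordinates and the choice of the constant. -/

section Modification

variable {d : ℕ} {D : Set (Space d)} {Ω : Type*} [MeasurableSpace Ω] {μ : Measure Ω}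
  {W : Ω → Space d → ℝ} {Q : H D →L[ℝ] H D} {η : ℕ → ℝ} {e : ℕ → Space d → ℝ}
  {α β Ce Cη : ℝ}

/-- Setting a Gaussian field to zero on a null set gives a Gaussian field. -/
theorem IsCenteredGaussianField.indicator_compl (hW : IsCenteredGaussianField D μ W Q) {S : Set Ω}
    (hS : MeasurableSet S) (hS0 : μ S = 0) :
    IsCenteredGaussianField D μ (Sᶜ.indicator W) Q := by
  have hp : ∀ ω, MemLp (Sᶜ.indicator W ω) 2 ((volume : Measure (Space d)).restrict D) := by
    intro ω
    by_cases h : ω ∈ Sᶜ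
    · rw [Set.indicator_of_mem h]; exact hW.memLp_path ω
    · rw [Set.indicator_of_notMem h]; exact MemLp.zero
  have hae : ∀ᵐ ω ∂μ, (hp ω).toLp (Sᶜ.indicator W ω) = (hW.memLp_path ω).toLp (W ω) := by
    filter_upwards [compl_mem_ae_iff.2 hS0] with ω hω
    refine MemLp.toLp_congr _ _ ?_
    rw [Set.indicator_of_mem hω]
  have hin : ∀ f : H D, ∀ᵐ ω ∂μ, inner ℝ f ((hW.memLp_path ω).toLp (W ω))
      = inner ℝ f ((hp ω).toLp (Sᶜ.indicator W ω)) := fun f => by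
    filter_upwards [hae] with ω hω
    rw [hω]
  refine ⟨fun x hx => ?_, hp, ?_, fun f => ?_, fun f => ?_, fun f g => ?_⟩
  · have : (fun ω => Sᶜ.indicator W ω x) = Sᶜ.indicator fun ω => W ω x := by
      ext ω
      by_cases h : ω ∈ Sᶜ
      · rw [Set.indicator_of_mem h, Set.indicator_of_mem h]
      · rw [Set.indicator_of_notMem h, Set.indicator_of_notMem h, Pi.zero_apply]
    rw [this]
    exact (hW.measurable x hx).indicator hS.compl
  · exact hW.memLp_field.ae_eq (hae.mono fun ω h => h.symm)
  · exact (hW.gaussian f).congr (hin f)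
  · rw [← hW.mean_zero f]
    exact integral_congr_ae ((hin f).mono fun ω h => h.symm)
  · rw [← hW.covariance f g]
    refine integral_congr_ae ?_
    filter_upwards [hin f, hin g] with ω h1 h2
    rw [h1, h2]

theorem IsConvexPolygonalDomain.convex (hD : IsConvexPolygonalDomain D) : Convex ℝ D := by
  obtain ⟨s, rfl⟩ := hD.polygonal
  exact (convex_convexHull ℝ _).interior

theorem IsConvexPolygonalDomain.isOpen (hD : IsConvexPolygonalDomain D) : IsOpen D := by
  obtain ⟨s, rfl⟩ := hD.polygonal
  exact isOpen_interior

theorem IsConvexPolygonalDomain.isBounded (hD : IsConvexPolygonalDomain D) :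
    Bornology.IsBounded D := by
  obtain ⟨s, rfl⟩ := hD.polygonal
  exact (isBounded_convexHull.2 s.finite_toSet.isBounded).subset interior_subset

omit [MeasurableSpace Ω] in
theorem truncatedKL_eq_expansion (η : ℕ → ℝ) (e : ℕ → Space d → ℝ) (Z : ℕ → Ω → ℝ) (N : ℕ) :
    truncatedKL η e Z N = expansion e (fun i ω => Real.sqrt (η i) * Z i ω) N := by
  ext ω x
  exact Finset.sum_congr rfl fun i _ => by ring

theorem IsKLCoordinates.isCoordinateVersion {Z : ℕ → Ω → ℝ}
    (hZ : IsKLCoordinates D μ W η e Z) (hW : IsCenteredGaussianField D μ W Q)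
    (hQ : IsEigensystem D Q η e) :
    IsCoordinateVersion hW hQ fun i ω => Real.sqrt (η i) * Z i ω := by
  refine ⟨fun i => (hZ.measurable i).const_mul _, fun i => ?_⟩
  filter_upwards [hZ.coord i] with ω hω
  rw [hω, L2.inner_def]
  refine integral_congr_ae ?_
  filter_upwards [(hQ.memLp i).coeFn_toLp, (hW.memLp_path ω).coeFn_toLp] with x h1 h2
  rw [IsEigensystem.vec, IsCenteredGaussianField.path, h1, h2]
  rfl

omit [MeasurableSpace Ω] in
theorem abs_expansion_le (he : EigenBounds D η e α β Ce Cη) (Y : ℕ → Ω → ℝ) (N : ℕ) (ω : Ω)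
    {x : Space d} (hx : x ∈ D) :
    |expansion e Y N ω x| ≤ ∑ i ∈ Finset.range N, Ce * |Y i ω| := by
  refine (Finset.abs_sum_le_sum_abs _ _).trans (Finset.sum_le_sum fun i _ => ?_)
  rw [abs_mul]
  gcongr
  exact he.bound i x hx

theorem measurable_expansion_apply (e : ℕ → Space d → ℝ) {Y : ℕ → Ω → ℝ}
    (hY : ∀ i, Measurable (Y i)) (N : ℕ) (x : Space d) :
    Measurable fun ω => expansion e Y N ω x := by
  unfold expansion
  fun_prop

/-- The constant in the moment bounds. -/
theorem exists_constant [IsProbabilityMeasure μ] (hD : IsConvexPolygonalDomain D)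
    (hW : IsCenteredGaussianField D μ W Q) (hQ : IsEigensystem D Q η e)
    (he : EigenBounds D η e α β Ce Cη) (φ₁ φ₂ : ℝ) (q : ℝ≥0∞) :
    ∃ C : ℝ, 0 < C ∧ (0 < φ₂ → 1 ≤ q → q ≠ ∞ → ∃ K : ℝ≥0∞, K ≠ ∞ ∧
      ENNReal.ofReal (max φ₁ φ₁⁻¹) * K ^ (1 / q.toReal) ≤ ENNReal.ofReal C ∧
      IsDominatedField D μ (q.toReal * φ₂) K W ∧
      ∀ Y : ℕ → Ω → ℝ, IsCoordinateVersion hW hQ Y → ∀ N,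
        IsDominatedField D μ (q.toReal * φ₂) K (expansion e Y N)) := by
  -- A value is required for every `q`, including inadmissible ones, where `1` is used. In the
  -- admissible case the added `1` makes the constant strictly positive.
  by_cases h : 0 < φ₂ ∧ 1 ≤ q ∧ q ≠ ∞
  · obtain ⟨h2, hq1, hqT⟩ := h
    have hq0 : 0 < q.toReal := ENNReal.toReal_pos (zero_lt_one.trans_le hq1).ne' hqT
    obtain ⟨K, hK, hKW, hKN⟩ := exists_isDominatedField hD.convex hD.isOpen hD.isBounded
      hD.nonempty hW hQ he (lam := q.toReal * φ₂) (by positivity)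
    set c := ENNReal.ofReal (max φ₁ φ₁⁻¹) * K ^ (1 / q.toReal) with hc
    have hcT : c ≠ ∞ := ENNReal.mul_ne_top ENNReal.ofReal_ne_top
      (ENNReal.rpow_ne_top_of_nonneg (by positivity) hK)
    refine ⟨c.toReal + 1, by positivity, fun _ _ _ => ⟨K, hK, ?_, hKW, hKN⟩⟩
    rw [ENNReal.le_ofReal_iff_toReal_le hcT (by positivity)]
    linarith
  · exact ⟨1, one_pos, fun h2 hq1 hqT => (h ⟨h2, hq1, hqT⟩).elim⟩

end Modification

end JumpDiffusion

end

theorem mainTheorem7 {d : ℕ} (hd : d = 1 ∨ d = 2) {D : Set (JumpDiffusion.Space d)}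
    (hD : JumpDiffusion.IsConvexPolygonalDomain D)
    {Ω : Type*} [MeasurableSpace Ω] (μ : Measure Ω) [IsProbabilityMeasure μ] [μ.IsComplete]
    (W : Ω → JumpDiffusion.Space d → ℝ) (Q : JumpDiffusion.H D →L[ℝ] JumpDiffusion.H D)
    (η : ℕ → ℝ) (e : ℕ → JumpDiffusion.Space d → ℝ) (α β Ce Cη : ℝ)
    (hW : JumpDiffusion.IsCenteredGaussianField D μ W Q)
    (hQ : JumpDiffusion.IsEigensystem D Q η e)
    (he : JumpDiffusion.EigenBounds D η e α β Ce Cη)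
    (φ₁ φ₂ : ℝ) :
    -- the constant depends on `q`, `φ₁`, `φ₂` and the Gaussian field only
    ∃ C : ℝ≥0∞ → ℝ, (∀ q, 0 < C q) ∧
      ∀ (abar : JumpDiffusion.Space d → ℝ) (A : ℝ) (Φ : ℝ → ℝ) (φ₃ φ₄ : ℝ)
        (b₁ b₂ : JumpDiffusion.Space d → Fin d → ℝ)
        (τ : Ω → ℕ) (T : ℕ → Ω → Set (JumpDiffusion.Space d)) (J : ℕ → Ω → ℝ) (Pbar : ℝ),
        JumpDiffusion.IsMeanCoefficient D abar A →
        JumpDiffusion.IsLinkFunction Φ φ₁ φ₂ φ₃ φ₄ →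
        MemLp b₁ ⊤ (volume.restrict D) → MemLp b₂ ⊤ (volume.restrict D) →
        JumpDiffusion.IsRandomPartition D τ T →
        0 < Pbar → JumpDiffusion.IsJumpSequence J Pbar →
        IndepFun (fun ω i => J i ω) τ μ →
        -- the exact coefficients `a`, `b`
        (let a := JumpDiffusion.diffusionCoeff abar Φ W τ T J;
          JumpDiffusion.CoeffMeasurable D a (JumpDiffusion.advectionCoeff a b₁ b₂) ∧
          (∀ᵐ ω ∂μ, JumpDiffusion.CoeffBounded D a ω) ∧
          -- after a change of `W` on a null set, the bounds hold at every `ω`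
          (∃ W' : Ω → JumpDiffusion.Space d → ℝ, (∀ᵐ ω ∂μ, W' ω = W ω) ∧
            JumpDiffusion.IsCenteredGaussianField D μ W' Q ∧
            (let a' := JumpDiffusion.diffusionCoeff abar Φ W' τ T J;
              JumpDiffusion.CoeffMeasurable D a' (JumpDiffusion.advectionCoeff a' b₁ b₂) ∧
              ∀ ω, JumpDiffusion.CoeffBounded D a' ω)) ∧
          ∀ q : ℝ≥0∞, 1 ≤ q → q ≠ ⊤ →
            JumpDiffusion.InLqWithBound μ q
              (fun ω => 1 / (JumpDiffusion.essInfOn D a ω).toReal) (C q) ∧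
            JumpDiffusion.InLqWithBound μ q
              (fun ω => (JumpDiffusion.essSupOn D a ω).toReal) (A + C q + Pbar)) ∧
        -- the approximated coefficients `a_{N,ε}`, `b_{N,ε}`
        (∀ (Z : ℕ → Ω → ℝ) (N : ℕ) (s ε : ℝ) (J' : ℕ → Ω → ℝ),
          JumpDiffusion.IsKLCoordinates D μ W η e Z →
          1 < s → 0 < ε → JumpDiffusion.IsBiasedSample μ J J' Pbar s ε →
          let aNε := JumpDiffusion.diffusionCoeff abar Φ
            (JumpDiffusion.truncatedKL η e Z N) τ T J';
          JumpDiffusion.CoeffMeasurable D aNε (JumpDiffusion.advectionCoeff aNε b₁ b₂) ∧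
          (∀ ω, JumpDiffusion.CoeffBounded D aNε ω) ∧
          ∀ q : ℝ≥0∞, 1 ≤ q → q ≠ ⊤ →
            JumpDiffusion.InLqWithBound μ q
              (fun ω => 1 / (JumpDiffusion.essInfOn D aNε ω).toReal) (C q) ∧
            JumpDiffusion.InLqWithBound μ q
              (fun ω => (JumpDiffusion.essSupOn D aNε ω).toReal) (A + C q + Pbar)) := by
  choose C hC0 hC using fun q => JumpDiffusion.exists_constant hD hW hQ he φ₁ φ₂ q
  refine ⟨C, hC0, fun abar A Φ φ₃ φ₄ b₁ b₂ τ T J Pbar habar hΦ _ _ hT hP hJ _ => ⟨?_, ?_⟩⟩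
  · intro a
    have hbdd : ∀ᵐ ω ∂μ, JumpDiffusion.CoeffBounded D a ω := by
      obtain ⟨K, hK, hKW, -⟩ := JumpDiffusion.exists_isDominatedField hD.convex hD.isOpen
        hD.isBounded hD.nonempty hW hQ he one_pos
      exact JumpDiffusion.ae_coeffBounded hD.isOpen habar hΦ hT hP.le hJ one_pos hK hKW
    refine ⟨JumpDiffusion.coeffMeasurable_diffusionCoeff hΦ hT hJ hW.measurable b₁ b₂, hbdd, ?_,
      fun q hq1 hqT => ?_⟩
    -- Replacing `W` by `0` on a measurable null set containing all bad `ω` makes the deterministic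
    -- bounds hold there with `m = 0`.
    · set S := toMeasurable μ {ω | ¬ JumpDiffusion.CoeffBounded D a ω} with hS
      have hS0 : μ S = 0 := by rw [hS, measure_toMeasurable]; exact hbdd
      have hW' := hW.indicator_compl (measurableSet_toMeasurable μ _) hS0
      refine ⟨Sᶜ.indicator W, ?_, hW', ?_⟩
      · filter_upwards [compl_mem_ae_iff.2 hS0] with ω hω
        exact Set.indicator_of_mem hω W
      · intro a'
        refine ⟨JumpDiffusion.coeffMeasurable_diffusionCoeff hΦ hT hJ hW'.measurable b₁ b₂,
          fun ω => ?_⟩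
        by_cases hω : ω ∈ S
        · refine JumpDiffusion.coeffBounded_of_bound (m := 0) hD.isOpen habar hΦ hT hP.le hJ
            (Filter.Eventually.of_forall fun x => ?_)
          rw [Set.indicator_of_notMem (Set.notMem_compl_iff.2 hω), Pi.zero_apply, abs_zero]
        · have h1 : JumpDiffusion.CoeffBounded D a ω := by
            by_contra h
            exact hω (subset_toMeasurable μ _ h)
          have h2 : a' ω = a ω := by
            ext x
            simp only [a', a, JumpDiffusion.diffusionCoeff,
              Set.indicator_of_mem (Set.mem_compl hω)]
          rw [JumpDiffusion.CoeffBounded, JumpDiffusion.essInfOn, JumpDiffusion.essSupOn, h2]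
          exact h1
    · obtain ⟨K, hK, hKC, hKW, -⟩ := hC q hΦ.φ₂_pos hq1 hqT
      exact JumpDiffusion.inLqWithBound_coeff hD.isOpen hD.nonempty habar hΦ hT hP.le hJ
        (JumpDiffusion.hasMeasurableVersion_field hD.isOpen hW hQ he) hq1 hqT hK hKW (hC0 q).le
        hKC
  · intro Z N s ε J' hZ _ _ hJ' aNε
    have hY := hZ.isCoordinateVersion hW hQ
    have hZY := JumpDiffusion.truncatedKL_eq_expansion η e Z N
    simp only [aNε, hZY]
    refine ⟨JumpDiffusion.coeffMeasurable_diffusionCoeff hΦ hT hJ'.jumps (fun x _ =>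
        JumpDiffusion.measurable_expansion_apply e hY.measurable N x) b₁ b₂, fun ω => ?_,
      fun q hq1 hqT => ?_⟩
    -- No exceptional set arises here: for each `ω` the truncated expansion is a finite sum of
    -- functions bounded on `D`.
    · exact JumpDiffusion.coeffBounded_of_bound hD.isOpen habar hΦ hT hP.le hJ'.jumps
        ((ae_restrict_mem hD.isOpen.measurableSet).mono fun x hx =>
          JumpDiffusion.abs_expansion_le he _ N ω hx)
    · obtain ⟨K, hK, hKC, -, hKN⟩ := hC q hΦ.φ₂_pos hq1 hqT
      exact JumpDiffusion.inLqWithBound_coeff hD.isOpen hD.nonempty habar hΦ hT hP.le hJ'.jumps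
        (JumpDiffusion.hasMeasurableVersion_expansion hD.isOpen he hY.measurable N) hq1 hqT hK
        (hKN _ hY N) (hC0 q).le hKC
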